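/- **Setting.** Let $\mathcal D\subset\mathbb R^k$ be compact with volume $W>0$, possibly with periodic boundary conditions along a discrete group of translations of $\mathbb R^k$ (whose translates of $\mathcal D$ overlap in null sets), and Neumann conditions on the rest of the boundary. Assume that the corresponding Laplacian $-\Delta_{\mathcal D}$ has compact resolvent and a non-degenerate ground state (the constant function), and let $\varphi_n$, $n\ge 1$, be an orthonormal system of its remaining eigenfunctions with eigenvalues $E_n>0$. The Coulomb potential of the tube $\mathbb R\times\mathcal D$ is, for $z=(x,y)$, $z'=(x',y')$, $$V(z,z')=-\frac{|x-x'|}{2W}+V_2(y,y';|x-x'|),\qquad V_2(y,y';t)=\sum_{n\ge1}\frac{e^{-t\sqrt{E_n}}}{2\sqrt{E_n}}\,\overline{\varphi_n(y)}\,\varphi_n(y').$$ Assume that for all $t>0$ and $y,y'\in\mathcal D$ the series converges, that $\int_{\mathcal D}V_2(y,y';t)\,dy=0$, and that there is a positive decreasing function $g$ on $[0,\infty)$ with $\int_0^\infty t\,g(t)\,dt<\infty$ such that $V_2(y,y';t)\ge -g(t)$ for all $t>0$ and, for each $\varepsilon>0$, $V_2(y,y';t)\le c(\varepsilon)\,g(t)$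 for all $t\ge\varepsilon$, with some $c(\varepsilon)>0$. Let $\rho,q>0$ and $\lambda=(\rho W)^{-1}$. For $\theta\in[0,1)$ and $n_1,n_2\in\mathbb Z$ with $N=n_1+n_2\ge 0$ put $L_1=(-n_1-\theta)\lambda$, $L_2=(n_2-\theta)\lambda$, and let $\mu^{(\beta,W,\theta)}_{[n_1,n_2]}$ be the Gibbs probability measure with density proportional to $e^{-\beta U}$ with respect to Lebesgue measure on the configurations $\omega=(z_1,\dots,z_N)$, $z_j=(x_j,y_j)$, $L_1<x_1<\dots<x_N<L_2$, $y_j\in\mathcal D$, where $$U(\omega)=\sum_{1\le j<k\le N}q^2V(z_j,z_k)-\sum_{j=1}^N q^2\rho\int_{[L_1,L_2]\times\mathcal D}V(z_j,z)\,dz .$$ Let $K(u;\omega)=\frac{u-L_1}{\lambda}-|\{j:\ x_j\le u\}|$ for $u\in[L_1,L_2]$ and $K(u;\omega)=0$ for $u\notin[L_1,L_2]$. **Theorem (vanishing of $K$'s volume-averages).** Fix such a system ($\mathcal D$ with its boundary conditions, $\rho$, $q$) and $\beta>0$. There is $\alpha>0$ such that for every $\delta>0$ there is $\widetilde C=\widetilde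 C(\delta)<\infty$ with $$\mu^{(\beta,W,\theta)}_{[n_1,n_2]}\left(\left\{\frac1r\left|\int_0^rK(x+u;\omega)\,du\right|\ge\delta\right\}\right)\le\widetilde C\,e^{-\alpha\delta^2 r}$$ for all $\theta\in[0,1)$, all $n_1,n_2\in\mathbb Z$ with $n_1+n_2\ge0$, all $x\in\mathbb R$ and all $r>0$. In particular $\alpha$ does not depend on $\delta$, and $\alpha,\widetilde C$ do not depend on $\theta,n_1,n_2,x,r$. -/

import Mathlib

open MeasureTheory Set

namespace Jellium

noncomputable section

/-- The Euclidean space containing the cross-section of the tube. -/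
abbrev Vec (k : ℕ) : Type := EuclideanSpace ℝ (Fin k)

/-- A cross-section: a compact set `carrier ⊆ ℝᵏ` of positive volume, together with a discrete group
`periods` of translations along which periodic boundary conditions are imposed (the translates of
`carrier` overlap in null sets only). With `periods = ⊥` all boundary conditions are Neumann; the
periodic strip is `carrier = [0, W]`, `periods = W ℤ`. -/
structure CrossSection (k : ℕ) where
  carrier : Set (Vec k)
  periods : AddSubgroup (Vec k)
  isCompact_carrier : IsCompact carrier
  discrete_periods : DiscreteTopology periods
  overlap_null : ∀ v ∈ periods, v ≠ 0 → volume (carrier ∩ (fun y => v + y) '' carrier) = 0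
  volume_pos : 0 < volume carrier

variable {k : ℕ}

/-- The total measure `W` of the cross-section. -/
def CrossSection.W (D : CrossSection k) : ℝ := volume.real D.carrier

/-- The interior of the union of all translates of the cross-section by the periods. -/
def CrossSection.unfolded (D : CrossSection k) : Set (Vec k) :=
  interior (⋃ v ∈ D.periods, (fun y => v + y) '' D.carrier)

/-- `u` belongs to the Sobolev space `H¹` of the cross-section, with the given periodicities and no
condition on the remaining part of the boundary, and `G` is its weak gradient. -/
structure CrossSection.IsH1 (D : CrossSection k) (u : Vec k → ℝ) (G : Vec k → Vec k) : Prop where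
  periodic : ∀ v ∈ D.periods, ∀ y, u (v + y) = u y
  periodic_grad : ∀ v ∈ D.periods, ∀ y, G (v + y) = G y
  memLp : MemLp u 2 (volume.restrict D.carrier)
  memLp_grad : MemLp G 2 (volume.restrict (D.carrier ∩ D.unfolded))
  weak_grad : ∀ η : Vec k → ℝ, ContDiff ℝ (⊤ : ℕ∞) η → HasCompactSupport η → tsupport η ⊆ D.unfolded →
    ∀ e : Vec k, ∫ y, u y * fderiv ℝ η y e = - ∫ y, inner ℝ (G y) e * η y

/-- `u` is in the domain of the (periodic / Neumann) Laplacian of the cross-section and `-Δ u = f`;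
this is the self-adjoint operator of the Dirichlet form `∫ ∇u · ∇ψ` on `H¹`. -/
def CrossSection.IsNegLaplacian (D : CrossSection k) (u f : Vec k → ℝ) : Prop :=
  ∃ G : Vec k → Vec k, D.IsH1 u G ∧ ∀ (ψ : Vec k → ℝ) (H : Vec k → Vec k), D.IsH1 ψ H →
    ∫ y in D.carrier ∩ D.unfolded, inner ℝ (G y) (H y) = ∫ y in D.carrier, f y * ψ y

/-- The spectral assumption on the cross-section: the Laplacian has compact resolvent and its ground
state, the constant function, is non-degenerate. Equivalently the constant function together with
eigenfunctions `φ n` of strictly positive eigenvalues `ev n`, finitely many of them below every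
bound, is an orthonormal basis of `L²`. (The index `n` runs over the excited states only.) -/
structure CrossSection.IsEigenbasis (D : CrossSection k) {ι : Type} (ev : ι → ℝ)
    (φ : ι → Vec k → ℝ) : Prop where
  measurable : ∀ n, Measurable (φ n)
  eigen : ∀ n, D.IsNegLaplacian (φ n) (fun y => ev n * φ n y)
  ev_pos : ∀ n, 0 < ev n
  ev_finite : ∀ M : ℝ, {n | ev n ≤ M}.Finite
  norm_one : ∀ n, ∫ y in D.carrier, φ n y * φ n y = 1
  orthogonal : ∀ m n, m ≠ n → ∫ y in D.carrier, φ m y * φ n y = 0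
  orthogonal_const : ∀ n, ∫ y in D.carrier, φ n y = 0
  complete : ∀ f : Vec k → ℝ, MemLp f 2 (volume.restrict D.carrier) →
    ∫ y in D.carrier, f y = 0 → (∀ n, ∫ y in D.carrier, f y * φ n y = 0) →
    f =ᵐ[volume.restrict D.carrier] 0

/-- The `n`-th term of the eigenfunction expansion of the short-range part of the potential. -/
def modeTerm {ι : Type} (ev : ι → ℝ) (φ : ι → Vec k → ℝ) (y y' : Vec k) (t : ℝ) (n : ι) : ℝ :=
  (2 * √(ev n))⁻¹ * Real.exp (-t * √(ev n)) * φ n y * φ n y'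

/-- The short-range part `V₂(y, y'; t)` of the Coulomb potential, `t = |x - x'|`. -/
def V₂ {ι : Type} (ev : ι → ℝ) (φ : ι → Vec k → ℝ) (y y' : Vec k) (t : ℝ) : ℝ :=
  ∑' n, modeTerm ev φ y y' t n

/-- The standing assumptions on the cross-section and on the Coulomb potential of the tube: the
spectral assumption, convergence of the eigenfunction expansion, zero average of `V₂` over the
cross-section, and the bounds on `V₂` by a positive decreasing `g` with `∫₀^∞ x g(x) dx < ∞`. -/
structure CrossSection.IsAdmissible (D : CrossSection k) {ι : Type} (ev : ι → ℝ)
    (φ : ι → Vec k → ℝ) (g : ℝ → ℝ) : Prop where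
  eigenbasis : D.IsEigenbasis ev φ
  summable : ∀ t > 0, ∀ y ∈ D.carrier, ∀ y' ∈ D.carrier, Summable (modeTerm ev φ y y' t)
  average : ∀ t > 0, ∀ y' ∈ D.carrier, ∫ y in D.carrier, V₂ ev φ y y' t = 0
  g_pos : ∀ t, 0 ≤ t → 0 < g t
  g_anti : AntitoneOn g (Ici 0)
  g_finite : IntegrableOn (fun t => t * g t) (Ioi 0)
  lower : ∀ t > 0, ∀ y ∈ D.carrier, ∀ y' ∈ D.carrier, -g t ≤ V₂ ev φ y y' t
  upper : ∀ ε > 0, ∃ c > 0, ∀ t ≥ ε, ∀ y ∈ D.carrier, ∀ y' ∈ D.carrier, V₂ ev φ y y' t ≤ c * g t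

/-- The Coulomb potential of the tube `ℝ × D`. -/
def potential (D : CrossSection k) {ι : Type} (ev : ι → ℝ) (φ : ι → Vec k → ℝ)
    (z z' : ℝ × Vec k) : ℝ :=
  -|z.1 - z'.1| / (2 * D.W) + V₂ ev φ z.2 z'.2 |z.1 - z'.1|

/-- The energy of `N` particles of charge `-q` in `[L₁, L₂] × D` with a neutralizing background of
charge density `q ρ` (the self-interaction of the background being discarded). -/
def energy (D : CrossSection k) {ι : Type} (ev : ι → ℝ) (φ : ι → Vec k → ℝ) (ρ q L₁ L₂ : ℝ)
    {N : ℕ} (ω : Fin N → ℝ × Vec k) : ℝ :=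
  ∑ i, ∑ j ∈ Finset.Ioi i, q ^ 2 * potential D ev φ (ω i) (ω j)
    - ∑ j, q ^ 2 * ρ * ∫ z in Icc L₁ L₂ ×ˢ D.carrier, potential D ev φ (ω j) z

/-- Configurations of `N` particles in `[L₁, L₂] × D`, labelled in increasing order of their first
coordinates. -/
def configs (D : CrossSection k) (N : ℕ) (L₁ L₂ : ℝ) : Set (Fin N → ℝ × Vec k) :=
  {ω | (∀ j, (ω j).1 ∈ Ioo L₁ L₂ ∧ (ω j).2 ∈ D.carrier) ∧ StrictMono fun j => (ω j).1}

/-- The Lebesgue measure on configurations with the Boltzmann weight `exp (-β U)`. -/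
def boltzmann (D : CrossSection k) {ι : Type} (ev : ι → ℝ) (φ : ι → Vec k → ℝ)
    (ρ q β : ℝ) (N : ℕ) (L₁ L₂ : ℝ) : Measure (Fin N → ℝ × Vec k) :=
  (volume.restrict (configs D N L₁ L₂)).withDensity
    fun ω => ENNReal.ofReal (Real.exp (-β * energy D ev φ ρ q L₁ L₂ ω))

/-- The length `λ = (ρ W)⁻¹` of a cell which contains one particle on average. -/
def cell (D : CrossSection k) (ρ : ℝ) : ℝ := (ρ * D.W)⁻¹

/-- The left endpoint `L₁ = (-n₁ - θ) λ`. -/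
def left (D : CrossSection k) (ρ θ : ℝ) (n₁ : ℤ) : ℝ := (-n₁ - θ) * cell D ρ

/-- The right endpoint `L₂ = (n₂ - θ) λ`. -/
def right (D : CrossSection k) (ρ θ : ℝ) (n₂ : ℤ) : ℝ := (n₂ - θ) * cell D ρ

/-- The number of particles of the neutral system, `N = n₁ + n₂`. -/
def count (n₁ n₂ : ℤ) : ℕ := (n₁ + n₂).toNat

/-- The Gibbs equilibrium measure of the neutral system of `n₁ + n₂` particles in
`[L₁, L₂] × D`: the Boltzmann weight divided by the partition function. -/
def gibbs (D : CrossSection k) {ι : Type} (ev : ι → ℝ) (φ : ι → Vec k → ℝ) (ρ q β θ : ℝ)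
    (n₁ n₂ : ℤ) : Measure (Fin (count n₁ n₂) → ℝ × Vec k) :=
  let m := boltzmann D ev φ ρ q β (count n₁ n₂) (left D ρ θ n₁) (right D ρ θ n₂)
  (m univ)⁻¹ • m

/-- The particle-excess function `K(u; ω)`. -/
def excess (D : CrossSection k) (ρ L₁ L₂ : ℝ) {N : ℕ} (ω : Fin N → ℝ × Vec k) (u : ℝ) : ℝ :=
  open Classical in
  if u ∈ Icc L₁ L₂ then
    (u - L₁) / cell D ρ - ((Finset.univ.filter fun j => (ω j).1 ≤ u).card : ℝ)
  else 0

end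

end Jellium

/-! ### Summability of the decay function over a lattice -/

namespace Jellium

/-! Put γ = βq²ρ/2 and let λ be the cell length. On ordered configurations the linear part of the
potential together with the background is, up to a constant, a system of springs: -βU = const - γ Σ
(x_j - a_j)² - βq² Σ V₂, where a_j is the midpoint of the j-th cell (`energy_eq`). The background
does not feel V₂, whose average over the cross-section vanishes. Up to an error of order λ, the
integral of K over a window is at most the sum of the displacements x_j - a_j over the labels n₁ ≤ j
< n₂ of the window, plus the `spill` of particles lying on the wrong side of one end; its negative
is bounded in the same way, with the sign of the sum reversed (`exists_excess_bounds`).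

By the exponential Markov inequality it suffices to control an exponential moment with parameter t.
Completing the square turns the tilt of the springs in the window into the factor exp((n₂ -
n₁)t²/(4γ)) and a shift of their rest positions by t/(2γ). Since n₂ - n₁ is about r/λ, the choice t
= 2γλδ gives exp(-γλδ²r), provided that shifting the rest positions, with the spill included, costs
only a factor independent of the system (`exists_tilt`).

Such a shift is undone by two rigid translations of all particles beyond an end of the window
(`exists_surgery`). A translation changes only the interactions across the cut. These are harmless
when the two halves keep apart, because t g(t) is integrable, but not when particles crowd at the
cut. One therefore passes to regular cuts c₀ ≤ n ≤ c₁, towards which the outer particles protrude by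
a bounded amount, and puts the particles in between back near a slightly compressed lattice. This
costs energy and entropy linear in c₁ - c₀, at a rate independent of the threshold A that defines
regularity (`exists_energy_balance`). If no closer cuts are regular, the springs between c₀ and c₁
are already stretched, with a sum of squared displacements of order A(c₁ - c₀)
(`exists_regular_cuts`). For large A the spring energy gained dominates, and the sum over c₀ and c₁
is a geometric series. -/

theorem sum_comp_le_tsum {ι : Type*} {h : ℕ → ℝ} (h0 : ∀ m, 0 ≤ h m) (hs : Summable h)
    (F : Finset ι) (f : ι → ℕ) (hf : Set.InjOn f F) : ∑ i ∈ F, h (f i) ≤ ∑' m, h m := by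
  classical
  rw [← Finset.sum_image (f := h) hf]
  exact hs.sum_le_tsum _ fun i _ => h0 i

/-- The constant extension of a function on `[0, ∞)` to the negative half-line. -/
def cut (g : ℝ → ℝ) (t : ℝ) : ℝ := g (max t 0)

theorem cut_antitone {g : ℝ → ℝ} (hg : AntitoneOn g (Ici 0)) : Antitone (cut g) := fun s t h =>
  hg (by simp) (by simp) (max_le_max_right 0 h)

theorem cut_pos {g : ℝ → ℝ} (hg : ∀ t, 0 ≤ t → 0 < g t) (t : ℝ) : 0 < cut g t :=
  hg _ (le_max_right _ _)

theorem cut_of_nonneg {g : ℝ → ℝ} {t : ℝ} (ht : 0 ≤ t) : cut g t = g t := by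
  simp [cut, ht]

theorem cut_of_nonpos {g : ℝ → ℝ} {t : ℝ} (ht : t ≤ 0) : cut g t = g 0 := by
  simp [cut, ht]

theorem cut_le {g : ℝ → ℝ} (hg : AntitoneOn g (Ici 0)) (t : ℝ) : cut g t ≤ g 0 :=
  hg (by simp) (by simp) (le_max_right _ _)

/-- This is the integral test: on the cell from mε to (m+1)ε, monotonicity gives t g(t) ≥ mε
g((m+1)ε). -/
theorem summable_mul_of_integrable {g : ℝ → ℝ} (hg0 : ∀ t, 0 ≤ t → 0 < g t)
    (hg : AntitoneOn g (Ici 0)) (hi : IntegrableOn (fun t => t * g t) (Ioi 0)) {ε : ℝ}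
    (hε : 0 < ε) : Summable fun m : ℕ => (m + 1 : ℝ) * g (m * ε) := by
  have hmaj : Summable fun m : ℕ => (m : ℝ) * g ((m + 1 : ℕ) * ε) := by
    refine summable_of_sum_range_le (c := (ε ^ 2)⁻¹ * ∫ t in Ioi 0, t * g t)
      (fun m => mul_nonneg m.cast_nonneg (hg0 _ (by positivity)).le) fun n => ?_
    have hint : ∀ u v : ℝ, 0 ≤ u → u ≤ v →
        IntervalIntegrable (fun t => t * g t) volume u v := fun u v hu huv => by
      rw [intervalIntegrable_iff_integrableOn_Ioc_of_le huv]
      exact hi.mono_set fun t ht => hu.trans_lt ht.1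
    have hadj := intervalIntegral.sum_integral_adjacent_intervals (μ := volume)
      (f := fun t => t * g t) (a := fun m : ℕ => (m : ℝ) * ε) (n := n)
      fun k _ => hint _ _ (by positivity) (by gcongr; simp)
    have hle : ∑ m ∈ Finset.range n, (∫ t in ((m : ℝ) * ε)..((m + 1 : ℕ) : ℝ) * ε, t * g t)
        ≤ ∫ t in Ioi 0, t * g t := by
      rw [hadj, intervalIntegral.integral_of_le (by simp; positivity)]
      refine setIntegral_mono_set hi ?_ ?_
      · exact (ae_restrict_iff' measurableSet_Ioi).2 <| .of_forall fun t ht =>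
          mul_nonneg (le_of_lt ht) (hg0 t (le_of_lt ht)).le
      · exact LE.le.eventuallyLE fun t ht => by simpa using ht.1
    have hterm : ∀ m ∈ Finset.range n, (m : ℝ) * g ((m + 1 : ℕ) * ε) * ε ^ 2
        ≤ ∫ t in ((m : ℝ) * ε)..((m + 1 : ℕ) : ℝ) * ε, t * g t := by
      intro m _
      have hle : (m : ℝ) * ε ≤ ((m + 1 : ℕ) : ℝ) * ε := by gcongr; simp
      have := intervalIntegral.integral_mono_on hle
        (intervalIntegrable_const (c := (m : ℝ) * ε * g ((m + 1 : ℕ) * ε)))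
        (hint _ _ (by positivity) hle) fun t ht => ?_
      · rw [intervalIntegral.integral_const, smul_eq_mul] at this
        refine le_trans (le_of_eq ?_) this
        push_cast; ring
      · have h0 : (0 : ℝ) ≤ m * ε := by positivity
        exact mul_le_mul ht.1 (hg (h0.trans ht.1) (h0.trans hle) ht.2)
          (hg0 _ (h0.trans hle)).le (h0.trans ht.1)
    have := (Finset.sum_le_sum hterm).trans hle
    rw [← Finset.sum_mul] at this
    rw [inv_mul_eq_div, le_div_iff₀ (by positivity)]
    exact this
  -- The majorant lags by one index and vanishes at m = 0; two steps further on, m + 3 ≤ 3(m + 1)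
  -- suffices.
  rw [← summable_nat_add_iff 2]
  rw [← summable_nat_add_iff 1] at hmaj
  refine Summable.of_nonneg_of_le (fun m => ?_) (fun m => ?_) (hmaj.mul_left 3)
  · exact mul_nonneg (by positivity) (hg0 _ (by positivity)).le
  · have h1 : 0 ≤ g (((m + 1 + 1 : ℕ) : ℝ) * ε) := (hg0 _ (by positivity)).le
    have h2 : (0 : ℝ) ≤ m := m.cast_nonneg
    push_cast at h1 ⊢
    rw [show (m : ℝ) + 1 + 1 = m + 2 by ring] at h1 ⊢
    nlinarith

/-- For the interaction of one particle with all others when distances may be short by T: about T/ε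
of the terms are bounded only by g(0), and the others form a tail of a convergent series. -/
theorem exists_sum_cut_le {g : ℝ → ℝ} (hg0 : ∀ t, 0 ≤ t → 0 < g t) (hg : AntitoneOn g (Ici 0))
    (hi : IntegrableOn (fun t => t * g t) (Ioi 0)) {ε : ℝ} (hε : 0 < ε) :
    ∃ G : ℝ, 0 ≤ G ∧ ∀ {ι : Type} (F : Finset ι) (f : ι → ℕ), Set.InjOn f F → ∀ T : ℝ, 0 ≤ T →
      ∑ i ∈ F, cut g (f i * ε - T) ≤ G * (1 + T) := by
  have hs : Summable fun m : ℕ => cut g (m * ε) := by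
    refine Summable.of_nonneg_of_le (fun m => (cut_pos hg0 _).le) (fun m => ?_)
      (summable_mul_of_integrable hg0 hg hi hε)
    rw [cut_of_nonneg (by positivity)]
    have := hg0 (m * ε) (by positivity)
    have h2 : (0 : ℝ) ≤ m := m.cast_nonneg
    nlinarith
  have hS : 0 ≤ ∑' m : ℕ, cut g (m * ε) := tsum_nonneg fun m => (cut_pos hg0 _).le
  have hg00 := (hg0 0 le_rfl).le
  refine ⟨∑' m : ℕ, cut g (m * ε) + g 0 * (1 + ε⁻¹), by positivity, fun F f hf T hT => ?_⟩
  classical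
  set K := ⌈T / ε⌉₊ with hK
  have hKle : (K : ℝ) ≤ T / ε + 1 := (Nat.ceil_lt_add_one (by positivity)).le
  have hKge : T ≤ K * ε := by
    have := Nat.le_ceil (T / ε)
    rwa [div_le_iff₀ hε] at this
  rw [← Finset.sum_filter_add_sum_filter_not F fun i => f i < K]
  have h1 : ∑ i ∈ F with f i < K, cut g (f i * ε - T) ≤ K * g 0 := by
    have hc : (F.filter fun i => f i < K).card ≤ K := by
      have : (F.filter fun i => f i < K).card ≤ (Finset.range K).card :=
        Finset.card_le_card_of_injOn f (fun i hi => by simpa using (Finset.mem_filter.1 hi).2)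
          (hf.mono fun i hi => (Finset.mem_filter.1 hi).1)
      simpa using this
    calc ∑ i ∈ F with f i < K, cut g (f i * ε - T)
        ≤ ∑ i ∈ F with f i < K, g 0 := Finset.sum_le_sum fun i _ => cut_le hg _
      _ = (F.filter fun i => f i < K).card * g 0 := by simp
      _ ≤ K * g 0 := by gcongr
  have h2 : ∑ i ∈ F with ¬ f i < K, cut g (f i * ε - T) ≤ ∑' m : ℕ, cut g (m * ε) := by
    refine le_trans (Finset.sum_le_sum fun i hi => ?_)
      (sum_comp_le_tsum (fun m => (cut_pos hg0 _).le) hs (F.filter fun i => ¬ f i < K)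
        (fun i => f i - K) ?_)
    · have hi' : K ≤ f i := not_lt.1 (Finset.mem_filter.1 hi).2
      apply cut_antitone hg
      rw [Nat.cast_sub hi']
      linarith
    · intro i hi j hj hij
      have hi' := Finset.mem_filter.1 (Finset.mem_coe.1 hi)
      have hj' := Finset.mem_filter.1 (Finset.mem_coe.1 hj)
      exact hf hi'.1 hj'.1 (by simp only at hij; omega)
  have h3 : (K : ℝ) * g 0 ≤ (T / ε + 1) * g 0 := by gcongr
  have h4 : (T / ε + 1) * g 0 ≤ g 0 * (1 + ε⁻¹) * (1 + T) := by
    have : 0 ≤ g 0 * ε⁻¹ := by positivity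
    rw [div_eq_mul_inv]
    nlinarith [mul_nonneg hg00 hT]
  nlinarith [mul_nonneg hS hT]

/-- For the interaction of two half-lines across a cut: about n pairs have label distance n, which
is why the first moment of g is needed. -/
theorem exists_sum_pairs_cut_le {g : ℝ → ℝ} (hg0 : ∀ t, 0 ≤ t → 0 < g t)
    (hg : AntitoneOn g (Ici 0)) (hi : IntegrableOn (fun t => t * g t) (Ioi 0)) {ε : ℝ}
    (hε : 0 < ε) :
    ∃ G : ℝ, 0 ≤ G ∧ ∀ {N : ℕ} (c : ℕ),
      ∑ i : Fin N with i.val < c, ∑ j : Fin N with c ≤ j.val, cut g (((j : ℝ) - i) * ε) ≤ G := by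
  classical
  have hs : Summable fun x : ℕ × ℕ => cut g ((x.1 + x.2 : ℕ) * ε) := by
    rw [← Finset.HasAntidiagonal.sigmaAntidiagonalEquivProd.summable_iff]
    refine (summable_sigma_of_nonneg fun _ => (cut_pos hg0 _).le).2
      ⟨fun n => (hasSum_fintype _).summable, ?_⟩
    refine (summable_mul_of_integrable hg0 hg hi hε).congr fun n => ?_
    rw [tsum_fintype, Finset.sum_congr rfl (g := fun _ => g (n * ε))]
    · simp
    · rintro ⟨⟨a, b⟩, hx⟩ _
      have : a + b = n := by simpa using hx
      simp only [Finset.HasAntidiagonal.sigmaAntidiagonalEquivProd_apply]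
      rw [this, cut_of_nonneg (by positivity)]
  refine ⟨∑' x : ℕ × ℕ, cut g ((x.1 + x.2 : ℕ) * ε), tsum_nonneg fun x => (cut_pos hg0 _).le,
    fun {N} c => ?_⟩
  rw [← Finset.sum_product']
  -- The two coordinates add up to j - i - 1, so replacing j - i by their sum only increases `cut
  -- g`.
  have hinj : Set.InjOn (fun x : Fin N × Fin N => (c - 1 - x.1.val, x.2.val - c))
      ((Finset.univ.filter fun i : Fin N => i.val < c) ×ˢ
        (Finset.univ.filter fun j : Fin N => c ≤ j.val) : Finset (Fin N × Fin N)) := by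
    rintro ⟨i, j⟩ h ⟨i', j'⟩ h' he
    simp at h h' he
    ext <;> simp <;> omega
  refine le_trans (Finset.sum_le_sum fun x hx => ?_)
    ((Finset.sum_image (f := fun x : ℕ × ℕ => cut g ((x.1 + x.2 : ℕ) * ε)) hinj).symm.le.trans
      (hs.sum_le_tsum _ fun x _ => (cut_pos hg0 _).le))
  apply cut_antitone hg
  simp at hx
  gcongr
  rw [le_sub_iff_add_le]
  norm_cast
  omega

end Jellium

/-! ### Rearranging a configuration between two cuts -/

namespace Jellium

variable {k : ℕ}

/-- Interactions bounded below by `-g` and, away from the diagonal, above by `κ g`, together with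
the resulting bounds on sums over particles with spacing `ε`. -/
structure PairBounds (D : CrossSection k) (V : Vec k → Vec k → ℝ → ℝ) (g : ℝ → ℝ)
    (κ ε G : ℝ) : Prop where
  g_pos : ∀ t, 0 ≤ t → 0 < g t
  g_anti : AntitoneOn g (Ici 0)
  lower : ∀ t > 0, ∀ y ∈ D.carrier, ∀ y' ∈ D.carrier, -g t ≤ V y y' t
  upper : ∀ t ≥ ε, ∀ y ∈ D.carrier, ∀ y' ∈ D.carrier, V y y' t ≤ κ * g t
  κ_nonneg : 0 ≤ κ
  ε_pos : 0 < ε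
  G_nonneg : 0 ≤ G
  sum_le : ∀ {ι : Type} (F : Finset ι) (f : ι → ℕ), Set.InjOn f F → ∀ T : ℝ, 0 ≤ T →
    ∑ i ∈ F, cut g (f i * ε - T) ≤ G * (1 + T)
  sum_pairs_le : ∀ {N : ℕ} (c : ℕ),
    ∑ i : Fin N with i.val < c, ∑ j : Fin N with c ≤ j.val, cut g (((j : ℝ) - i) * ε) ≤ G

/-- The total interaction energy. -/
noncomputable def pairEnergy (V : Vec k → Vec k → ℝ → ℝ) {N : ℕ} (ω : Fin N → ℝ × Vec k) : ℝ :=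
  ∑ i, ∑ j ∈ Finset.Ioi i, V (ω i).2 (ω j).2 |(ω i).1 - (ω j).1|

/-- The energy of springs that bind the particles to the positions `p`. -/
noncomputable def springEnergy (γ : ℝ) (p : ℕ → ℝ) {N : ℕ} (ω : Fin N → ℝ × Vec k) : ℝ :=
  γ * ∑ j, ((ω j).1 - p j) ^ 2

/-- The total distance by which the first `n` particles lie to the right of `u` and the other
ones to the left of `u`. -/
noncomputable def spill (n : ℕ) (u : ℝ) {N : ℕ} (ω : Fin N → ℝ × Vec k) : ℝ :=
  ∑ j : Fin N, if (j : ℕ) < n then max ((ω j).1 - u) 0 else max (u - (ω j).1) 0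

/-- A lattice with constant `lam`, compressed so as to leave gaps `B` next to the sites `c₀`, `c₁`. -/
noncomputable def squeezed (P lam B : ℝ) (c₀ c₁ : ℕ) (j : ℕ) : ℝ :=
  min (max (P + j * lam) (P + c₀ * lam + B + ((j : ℝ) - c₀) * (lam / 2)))
    (P + c₁ * lam - B - ((c₁ : ℝ) - j) * (lam / 2))

/-- The extent to which `squeezed` is compressed. -/
noncomputable def gap (lam B : ℝ) (c₀ c₁ : ℕ) (j : ℕ) : ℝ :=
  max (B - ((j : ℝ) - c₀) * (lam / 2)) 0 + max (B - ((c₁ : ℝ) - j) * (lam / 2)) 0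

theorem gap_nonneg (lam B : ℝ) (c₀ c₁ j : ℕ) : 0 ≤ gap lam B c₀ c₁ j :=
  add_nonneg (le_max_right _ _) (le_max_right _ _)

theorem gap_le {lam B : ℝ} (hlam : 0 < lam) (hB : 0 ≤ B) {c₀ c₁ j : ℕ} (h₀ : c₀ ≤ j)
    (h₁ : j ≤ c₁) : gap lam B c₀ c₁ j ≤ 2 * B := by
  have e₀ : (0 : ℝ) ≤ (j : ℝ) - c₀ := by rw [sub_nonneg]; exact_mod_cast h₀
  have e₁ : (0 : ℝ) ≤ (c₁ : ℝ) - j := by rw [sub_nonneg]; exact_mod_cast h₁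
  have : max (B - ((j : ℝ) - c₀) * (lam / 2)) 0 ≤ B := max_le (by nlinarith) hB
  have : max (B - ((c₁ : ℝ) - j) * (lam / 2)) 0 ≤ B := max_le (by nlinarith) hB
  unfold gap
  linarith

/-- The compression fades linearly away from each cut, so it affects a number of sites depending
only on B and `lam`. -/
theorem exists_sum_gap_le {lam B : ℝ} (hlam : 0 < lam) :
    ∃ K : ℝ, 0 ≤ K ∧ ∀ N c₀ c₁ : ℕ,
      ∑ j : Fin N with c₀ ≤ j.val ∧ j.val < c₁, gap lam B c₀ c₁ j ≤ K := by
  have hs : Summable fun m : ℕ => max (B - m * (lam / 2)) 0 := by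
    refine summable_of_hasFiniteSupport ((Set.finite_lt_nat (⌈B / (lam / 2)⌉₊)).subset fun m hm => ?_)
    by_contra hlt
    rw [Set.mem_ofPred_eq, not_lt] at hlt
    refine hm (max_eq_right ?_)
    have := (Nat.le_ceil (B / (lam / 2))).trans (Nat.cast_le.2 hlt)
    rw [div_le_iff₀ (by positivity)] at this
    linarith
  have h0 : ∀ m : ℕ, 0 ≤ max (B - m * (lam / 2)) 0 := fun m => le_max_right _ _
  refine ⟨2 * ∑' m : ℕ, max (B - m * (lam / 2)) 0, by positivity, fun N c₀ c₁ => ?_⟩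
  simp only [gap]
  rw [Finset.sum_add_distrib, two_mul]
  refine add_le_add ?_ ?_
  · refine le_trans (Finset.sum_le_sum fun j hj => ?_)
      (sum_comp_le_tsum h0 hs _ (fun j : Fin N => (j : ℕ) - c₀) ?_)
    · simp only [Finset.mem_filter] at hj
      rw [Nat.cast_sub hj.2.1]
    · intro i hi j hj h
      simp at hi hj h
      ext; omega
  · refine le_trans (Finset.sum_le_sum fun j hj => ?_)
      (sum_comp_le_tsum h0 hs _ (fun j : Fin N => c₁ - (j : ℕ)) ?_)
    · simp only [Finset.mem_filter] at hj
      rw [Nat.cast_sub hj.2.2.le]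
    · intro i hi j hj h
      simp at hi hj h
      ext; omega

theorem abs_squeezed_sub_le {P lam B : ℝ} {c₀ c₁ : ℕ} (j : ℕ) :
    |squeezed P lam B c₀ c₁ j - (P + j * lam)| ≤ gap lam B c₀ c₁ j := by
  unfold squeezed gap
  rw [abs_le]
  rcases max_cases (P + j * lam) (P + c₀ * lam + B + ((j : ℝ) - c₀) * (lam / 2)) with h | h <;>
  rcases max_cases (B - ((j : ℝ) - c₀) * (lam / 2)) 0 with h' | h' <;>
  rcases max_cases (B - ((c₁ : ℝ) - j) * (lam / 2)) 0 with h'' | h'' <;>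
  rcases min_cases (max (P + j * lam) (P + c₀ * lam + B + ((j : ℝ) - c₀) * (lam / 2)))
    (P + c₁ * lam - B - ((c₁ : ℝ) - j) * (lam / 2)) with h₃ | h₃ <;>
  constructor <;> linarith

theorem squeezed_le {P lam B : ℝ} {c₀ c₁ : ℕ} (j : ℕ) :
    squeezed P lam B c₀ c₁ j ≤ P + c₁ * lam - B - ((c₁ : ℝ) - j) * (lam / 2) := min_le_right _ _

/-- The hypothesis makes the two lines of slope `lam / 2` from the cuts compatible, so that the left
gap survives the minimum. -/
theorem le_squeezed {P lam B : ℝ} {c₀ c₁ : ℕ} (h : 4 * B ≤ ((c₁ : ℝ) - c₀) * lam) (j : ℕ) :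
    P + c₀ * lam + B + ((j : ℝ) - c₀) * (lam / 2) ≤ squeezed P lam B c₀ c₁ j :=
  le_min (le_max_right _ _) (by linarith)

theorem squeezed_increment {P lam B : ℝ} (hlam : 0 ≤ lam) {c₀ c₁ i j : ℕ} (h : i ≤ j) :
    ((j : ℝ) - i) * (lam / 2) ≤ squeezed P lam B c₀ c₁ j - squeezed P lam B c₀ c₁ i := by
  have hij : (0 : ℝ) ≤ ((j : ℝ) - i) * lam :=
    mul_nonneg (by rw [sub_nonneg]; exact_mod_cast h) hlam
  rw [le_sub_iff_add_le]
  unfold squeezed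
  refine le_min ?_ ?_
  · refine le_trans (add_le_add_right (min_le_left _ _) _) ?_
    rcases max_cases (P + i * lam) (P + c₀ * lam + B + ((i : ℝ) - c₀) * (lam / 2)) with h | h
    · rw [h.1]; exact le_trans (by linarith) (le_max_left _ _)
    · rw [h.1]; exact le_trans (by linarith) (le_max_right _ _)
  · refine le_trans (add_le_add_right (min_le_right _ _) _) (by linarith)

/-- The configuration `ω'` arises from `ω` by moving the particles with index at least `c₁` by `s`
and placing those with index in `[c₀, c₁)` near the positions `squeezed`; the other particles of
`ω` stay away from the cuts `c₀` and `c₁`. -/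
structure Surgery (D : CrossSection k) (P lam R A s ℓ ℓ' : ℝ) (c₀ c₁ : ℕ) {N : ℕ}
    (ω ω' : Fin N → ℝ × Vec k) : Prop where
  lam_pos : 0 < lam
  R_nonneg : 0 ≤ R
  A_nonneg : 0 ≤ A
  wall_left : |ℓ - P| ≤ R
  wall_right : |ℓ' - (P + N * lam)| ≤ R
  wall_right' : |ℓ' + s - (P + N * lam)| ≤ R
  le_card : c₁ ≤ N
  room : 4 * (A + 2 * R + lam) ≤ ((c₁ : ℝ) - c₀) * lam
  mem : ω ∈ configs D N ℓ ℓ'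
  left : ∀ j : Fin N, (j : ℕ) < c₀ → (ω j).1 ≤ P + c₀ * lam + A - ((c₀ : ℝ) - j) * (lam / 2)
  right : ∀ j : Fin N, c₁ ≤ (j : ℕ) → P + c₁ * lam - A + ((j : ℝ) - c₁) * (lam / 2) ≤ (ω j).1
  left_eq : ∀ j : Fin N, (j : ℕ) < c₀ → ω' j = ω j
  right_eq : ∀ j : Fin N, c₁ ≤ (j : ℕ) → ω' j = ((ω j).1 + s, (ω j).2)
  mid_mem : ∀ j : Fin N, c₀ ≤ (j : ℕ) → (j : ℕ) < c₁ → (ω' j).2 ∈ D.carrier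
  mid_Icc : ∀ j : Fin N, c₀ ≤ (j : ℕ) → (j : ℕ) < c₁ → (ω' j).1 ∈
    Icc (squeezed P lam (A + 2 * R + lam) c₀ c₁ j)
      (squeezed P lam (A + 2 * R + lam) c₀ c₁ j + lam / 4)

namespace Surgery

variable {D : CrossSection k} {P lam R A s ℓ ℓ' : ℝ} {c₀ c₁ N : ℕ} {ω ω' : Fin N → ℝ × Vec k}

theorem abs_shift_le (h : Surgery D P lam R A s ℓ ℓ' c₀ c₁ ω ω') : |s| ≤ 2 * R := by
  have h1 := abs_le.1 h.wall_right
  have h2 := abs_le.1 h.wall_right'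
  rw [abs_le]
  constructor <;> linarith

theorem cuts_le (h : Surgery D P lam R A s ℓ ℓ' c₀ c₁ ω ω') : c₀ ≤ c₁ := by
  by_contra! hlt
  have h1 : (c₁ : ℝ) ≤ c₀ := by exact_mod_cast hlt.le
  nlinarith [h.room, h.lam_pos, h.A_nonneg, h.R_nonneg]

/-- The compressed lattice has spacing at least `lam / 2`, and the placement window of width `lam /
4` costs at most half of it. The gap exceeds the protrusion A of the outer particles by 2R, which
absorbs the translation s, and by a further `lam`. -/
theorem separated (h : Surgery D P lam R A s ℓ ℓ' c₀ c₁ ω ω') {i j : Fin N} (hij : i < j)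
    (hj : c₀ ≤ (j : ℕ)) (hi : (i : ℕ) < c₁) :
    ((j : ℝ) - i) * (lam / 4) ≤ (ω' j).1 - (ω' i).1 := by
  have hlam := h.lam_pos
  have hR := h.R_nonneg
  have hA := h.A_nonneg
  have hs := abs_le.1 h.abs_shift_le
  have hroom := h.room
  have hij' : lam ≤ ((j : ℝ) - i) * lam := by
    have : (i : ℝ) + 1 ≤ j := by exact_mod_cast hij
    nlinarith
  rcases lt_or_ge (i : ℕ) c₀ with hi0 | hi0
  · have h1 := h.left i hi0
    rw [h.left_eq i hi0]
    rcases lt_or_ge (j : ℕ) c₁ with hj1 | hj1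
    · have h2 := (h.mid_Icc j hj hj1).1
      have h3 := le_squeezed (P := P) hroom j
      linarith
    · rw [h.right_eq j hj1]
      have h2 := h.right j hj1
      simp only
      linarith
  · have h1 := h.mid_Icc i hi0 hi
    rcases lt_or_ge (j : ℕ) c₁ with hj1 | hj1
    · have h2 := (h.mid_Icc j hj hj1).1
      have h3 := squeezed_increment (P := P) (B := A + 2 * R + lam) (c₀ := c₀) (c₁ := c₁) hlam.le
        (show (i : ℕ) ≤ j from hij.le)
      linarith [h1.2]
    · rw [h.right_eq j hj1]
      have h2 := h.right j hj1
      have h3 := squeezed_le (P := P) (lam := lam) (B := A + 2 * R + lam) (c₀ := c₀) (c₁ := c₁) i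
      simp only
      linarith [h1.2]

theorem mem_configs (h : Surgery D P lam R A s ℓ ℓ' c₀ c₁ ω ω') : ω' ∈ configs D N ℓ (ℓ' + s) := by
  have hlam := h.lam_pos
  have hR := h.R_nonneg
  have hA := h.A_nonneg
  have hs := abs_le.1 h.abs_shift_le
  have hroom := h.room
  have hw := abs_le.1 h.wall_left
  have hw' := abs_le.1 h.wall_right'
  obtain ⟨hmem, hmono⟩ := h.mem
  have hc : (c₁ : ℝ) * lam ≤ N * lam := by have := h.le_card; gcongr
  have hc0 : 0 ≤ (c₀ : ℝ) * lam := by positivity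
  refine ⟨fun j => ?_, fun i j hij => ?_⟩
  · rcases lt_or_ge (j : ℕ) c₀ with hj0 | hj0
    · rw [h.left_eq j hj0]
      have h1 := h.left j hj0
      have h2 : (j : ℝ) * lam ≤ c₀ * lam := by gcongr
      exact ⟨⟨(hmem j).1.1, by linarith⟩, (hmem j).2⟩
    · rcases lt_or_ge (j : ℕ) c₁ with hj1 | hj1
      · have h1 := h.mid_Icc j hj0 hj1
        have h2 := le_squeezed (P := P) hroom j
        have h3 := squeezed_le (P := P) (lam := lam) (B := A + 2 * R + lam) (c₀ := c₀) (c₁ := c₁) j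
        have h4 : (j : ℝ) * lam ≤ c₁ * lam := by gcongr
        have h5 : (c₀ : ℝ) * lam ≤ j * lam := by gcongr
        exact ⟨⟨by linarith [h1.1], by linarith [h1.2]⟩, h.mid_mem j hj0 hj1⟩
      · rw [h.right_eq j hj1]
        have h1 := h.right j hj1
        have h4 : (c₁ : ℝ) * lam ≤ j * lam := by gcongr
        exact ⟨⟨by simp only; linarith, by simpa using (hmem j).1.2⟩, (hmem j).2⟩
  · rcases lt_or_ge (j : ℕ) c₀ with hj0 | hj0
    · simp only [h.left_eq j hj0, h.left_eq i (lt_trans hij hj0)]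
      exact hmono hij
    · rcases lt_or_ge (i : ℕ) c₁ with hi1 | hi1
      · have h1 := h.separated hij hj0 hi1
        have : (0 : ℝ) < ((j : ℝ) - i) * (lam / 4) :=
          mul_pos (by rw [sub_pos]; exact_mod_cast hij) (by positivity)
        simp only
        linarith
      · simp only [h.right_eq i hi1, h.right_eq j (hi1.trans hij.le)]
        have := hmono hij
        simpa using this

/-- The deviation of a particle from its lattice site, increased near the cuts. -/
noncomputable def range (P lam B : ℝ) (c₀ c₁ : ℕ) {N : ℕ} (ω : Fin N → ℝ × Vec k) (j : Fin N) : ℝ :=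
  |(ω j).1 - (P + j * lam)| + gap lam B c₀ c₁ j

theorem range_nonneg (P lam B : ℝ) (c₀ c₁ : ℕ) {N : ℕ} (ω : Fin N → ℝ × Vec k) (j : Fin N) :
    0 ≤ range P lam B c₀ c₁ ω j := add_nonneg (abs_nonneg _) (gap_nonneg _ _ _ _ _)

/-- Pairs on the same outer side keep their distance. For the others the upper bound applies after
the surgery, where separations are controlled, and the lower bound before it, where the separation
can fall short of the lattice distance by an amount governed by the `range` of a middle particle. -/
theorem pair_le {V : Vec k → Vec k → ℝ → ℝ} {g : ℝ → ℝ} {κ G : ℝ}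
    (hV : PairBounds D V g κ (lam / 4) G) (h : Surgery D P lam R A s ℓ ℓ' c₀ c₁ ω ω')
    {i j : Fin N} (hij : i < j) :
    V (ω' i).2 (ω' j).2 |(ω' i).1 - (ω' j).1| - V (ω i).2 (ω j).2 |(ω i).1 - (ω j).1| ≤
      (κ + 1) * ((if c₀ ≤ (i : ℕ) ∧ (i : ℕ) < c₁ then cut g (((j : ℝ) - i) * (lam / 4)
          - range P lam (A + 2 * R + lam) c₀ c₁ ω i) else 0)
        + (if c₀ ≤ (j : ℕ) ∧ (j : ℕ) < c₁ then cut g (((j : ℝ) - i) * (lam / 4)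
          - range P lam (A + 2 * R + lam) c₀ c₁ ω j) else 0)
        + (if (i : ℕ) < c₀ ∧ c₁ ≤ (j : ℕ) then cut g (((j : ℝ) - i) * (lam / 4)) else 0)) := by
  have hlam := h.lam_pos
  have hR := h.R_nonneg
  have hA := h.A_nonneg
  have hroom := h.room
  have hκ := hV.κ_nonneg
  have hanti := cut_antitone hV.g_anti
  have hpos := fun t => (cut_pos hV.g_pos t).le
  obtain ⟨hmem, hmono⟩ := h.mem
  obtain ⟨hmem', -⟩ := h.mem_configs
  have hx : (ω i).1 < (ω j).1 := hmono hij
  have hij' : (1 : ℝ) ≤ (j : ℝ) - i := by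
    rw [le_sub_iff_add_le]; have : (i : ℕ) + 1 ≤ j := hij
    rw [add_comm]; exact_mod_cast this
  set ri := range P lam (A + 2 * R + lam) c₀ c₁ ω i with hri
  set rj := range P lam (A + 2 * R + lam) c₀ c₁ ω j with hrj
  have hri0 : 0 ≤ ri := range_nonneg _ _ _ _ _ _ _
  have hrj0 : 0 ≤ rj := range_nonneg _ _ _ _ _ _ _
  -- The new interaction costs at most κw and the removal of the old one at most w.
  have key : c₀ ≤ (j : ℕ) → (i : ℕ) < c₁ → ∀ w : ℝ, 0 ≤ w →
      cut g (((j : ℝ) - i) * (lam / 4)) ≤ w → cut g ((ω j).1 - (ω i).1) ≤ w →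
      V (ω' i).2 (ω' j).2 |(ω' i).1 - (ω' j).1| - V (ω i).2 (ω j).2 |(ω i).1 - (ω j).1|
        ≤ (κ + 1) * w := by
    intro hj hi w hw h1 h2
    have hsep := h.separated hij hj hi
    have hm4 : lam / 4 ≤ ((j : ℝ) - i) * (lam / 4) := by nlinarith
    have e1 : |(ω' i).1 - (ω' j).1| = (ω' j).1 - (ω' i).1 := by
      rw [abs_sub_comm, abs_of_nonneg (by linarith)]
    have e2 : |(ω i).1 - (ω j).1| = (ω j).1 - (ω i).1 := by
      rw [abs_sub_comm, abs_of_nonneg (by linarith)]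
    rw [e1, e2]
    have l1 := hV.lower _ (sub_pos.2 hx) _ (hmem i).2 _ (hmem j).2
    have l2 := hV.upper _ (show (ω' j).1 - (ω' i).1 ≥ lam / 4 by linarith) _ (hmem' i).2 _
      (hmem' j).2
    rw [← cut_of_nonneg (g := g) (by linarith)] at l1 l2
    have l3 := (hanti hsep).trans h1
    have l4 : κ * cut g ((ω' j).1 - (ω' i).1) ≤ κ * w := by gcongr
    linarith
  rcases lt_or_ge (j : ℕ) c₀ with hj0 | hj0
  · have hi0 : (i : ℕ) < c₀ := lt_trans hij hj0
    rw [h.left_eq j hj0, h.left_eq i hi0, sub_self]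
    have := hpos
    refine mul_nonneg (by positivity) (add_nonneg (add_nonneg ?_ ?_) ?_) <;> split_ifs <;>
      first | exact hpos _ | exact le_rfl
  · rcases lt_or_ge (i : ℕ) c₁ with hi1 | hi1
    · rcases lt_or_ge (i : ℕ) c₀ with hi0 | hi0
      · rcases lt_or_ge (j : ℕ) c₁ with hj1 | hj1
        · rw [if_neg (by omega), if_pos ⟨hj0, hj1⟩, if_neg (by omega), zero_add, add_zero]
          refine key hj0 hi1 _ (hpos _) (hanti (by linarith)) (hanti ?_)
          have h1 := h.left i hi0
          have h2 := neg_abs_le ((ω j).1 - (P + j * lam))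
          -- The gap term in `range` pays for the protrusion A of the left particle beyond the cut.
          have h3 : A + 2 * R + lam - ((j : ℝ) - c₀) * (lam / 2) ≤
            gap lam (A + 2 * R + lam) c₀ c₁ j :=
            le_add_of_le_of_nonneg (le_max_left _ _) (le_max_right _ _)
          have h4 : rj = |(ω j).1 - (P + j * lam)| + gap lam (A + 2 * R + lam) c₀ c₁ j := rfl
          have h5 : lam ≤ ((j : ℝ) - i) * lam := by nlinarith
          linarith
        · rw [if_neg (by omega), if_neg (by omega), if_pos ⟨hi0, hj1⟩, zero_add, zero_add]
          refine key hj0 hi1 _ (hpos _) le_rfl (hanti ?_)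
          have h1 := h.left i hi0
          have h2 := h.right j hj1
          have h5 : lam ≤ ((j : ℝ) - i) * lam := by nlinarith
          linarith
      · rcases lt_or_ge (j : ℕ) c₁ with hj1 | hj1
        · rw [if_pos ⟨hi0, hi1⟩, if_pos ⟨hj0, hj1⟩, if_neg (by omega), add_zero]
          refine key hj0 hi1 _ (add_nonneg (hpos _) (hpos _))
            ((hanti (by linarith)).trans (le_add_of_nonneg_right (hpos _))) ?_
          have h2 := neg_abs_le ((ω j).1 - (P + j * lam))
          have h2' := le_abs_self ((ω i).1 - (P + i * lam))
          have h4 : rj = |(ω j).1 - (P + j * lam)| + gap lam (A + 2 * R + lam) c₀ c₁ j := rfl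
          have h4' : ri = |(ω i).1 - (P + i * lam)| + gap lam (A + 2 * R + lam) c₀ c₁ i := rfl
          have h6 := gap_nonneg lam (A + 2 * R + lam) c₀ c₁ j
          have h6' := gap_nonneg lam (A + 2 * R + lam) c₀ c₁ i
          have h5 : lam ≤ ((j : ℝ) - i) * lam := by nlinarith
          -- The larger range r is used: the old distance is at least (j - i)λ - 2r, which exceeds
          -- (j - i)λ/4 - r as long as the latter is nonnegative; otherwise `cut g` already takes
          -- its maximum g(0).
          rcases le_total ri rj with hr | hr
          · refine le_trans ?_ (le_add_of_nonneg_left (hpos _))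
            rcases le_total 0 (((j : ℝ) - i) * (lam / 4) - rj) with hp | hp
            · exact hanti (by linarith)
            · rw [cut_of_nonpos hp]; exact cut_le hV.g_anti _
          · refine le_trans ?_ (le_add_of_nonneg_right (hpos _))
            rcases le_total 0 (((j : ℝ) - i) * (lam / 4) - ri) with hp | hp
            · exact hanti (by linarith)
            · rw [cut_of_nonpos hp]; exact cut_le hV.g_anti _
        · rw [if_pos ⟨hi0, hi1⟩, if_neg (by omega), if_neg (by omega), add_zero, add_zero]
          refine key hj0 hi1 _ (hpos _) (hanti (by linarith)) (hanti ?_)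
          have h1 := h.right j hj1
          have h2 := le_abs_self ((ω i).1 - (P + i * lam))
          have h3 : A + 2 * R + lam - ((c₁ : ℝ) - i) * (lam / 2) ≤
            gap lam (A + 2 * R + lam) c₀ c₁ i :=
            le_add_of_nonneg_of_le (le_max_right _ _) (le_max_left _ _)
          have h4 : ri = |(ω i).1 - (P + i * lam)| + gap lam (A + 2 * R + lam) c₀ c₁ i := rfl
          have h5 : lam ≤ ((j : ℝ) - i) * lam := by nlinarith
          linarith
    · have hj1 : c₁ ≤ (j : ℕ) := hi1.trans hij.le
      rw [h.right_eq j hj1, h.right_eq i hi1]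
      simp only [add_sub_add_right_eq_sub, sub_self]
      refine mul_nonneg (by positivity) (add_nonneg (add_nonneg ?_ ?_) ?_) <;> split_ifs <;>
        first | exact hpos _ | exact le_rfl

end Surgery
end Jellium

/-! ### Energy cost of the rearrangement -/

namespace Jellium

variable {k : ℕ}

namespace Surgery

variable {D : CrossSection k} {P lam R A s ℓ ℓ' : ℝ} {c₀ c₁ N : ℕ} {ω ω' : Fin N → ℝ × Vec k}

/-- Each replaced particle pays a one-body sum on either side, affine in its range; the two outer
blocks pay a single bounded sum across the cut. -/
theorem pairEnergy_le {V : Vec k → Vec k → ℝ → ℝ} {g : ℝ → ℝ} {κ G : ℝ}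
    (hV : PairBounds D V g κ (lam / 4) G) (h : Surgery D P lam R A s ℓ ℓ' c₀ c₁ ω ω') :
    pairEnergy V ω' - pairEnergy V ω ≤ (κ + 1) *
      (2 * ∑ j : Fin N with c₀ ≤ j.val ∧ j.val < c₁,
        G * (1 + range P lam (A + 2 * R + lam) c₀ c₁ ω j) + G) := by
  classical
  have hκ := hV.κ_nonneg
  have hpos := fun t => (cut_pos hV.g_pos t).le
  unfold pairEnergy
  simp only [← Finset.sum_sub_distrib]
  have hpair := fun i j (hij : i < j) => h.pair_le hV hij
  refine (Finset.sum_le_sum fun i _ => Finset.sum_le_sum fun j hj =>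
    hpair i j (Finset.mem_Ioi.1 hj)).trans ?_
  generalize hS : ∑ j : Fin N with c₀ ≤ j.val ∧ j.val < c₁,
    G * (1 + range P lam (A + 2 * R + lam) c₀ c₁ ω j) = S
  simp only [← Finset.mul_sum]
  refine mul_le_mul_of_nonneg_left ?_ (by positivity)
  rw [Finset.sum_filter] at hS
  simp only [Finset.sum_add_distrib]
  rw [two_mul S]
  refine add_le_add (add_le_add ?_ ?_) ?_
  · rw [← hS]
    refine Finset.sum_le_sum fun i _ => ?_
    split_ifs
    · refine le_trans (Finset.sum_le_sum fun j hj => le_of_eq ?_)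
        (hV.sum_le (Finset.Ioi i) (fun j : Fin N => (j : ℕ) - i) ?_ _
          (range_nonneg P lam (A + 2 * R + lam) c₀ c₁ ω i))
      · rw [Nat.cast_sub (show (i : ℕ) ≤ j from (Finset.mem_Ioi.1 hj).le)]
      · intro j hj j' hj' he
        simp at hj hj' he
        ext; omega
    · simp
  · rw [← hS, Finset.sum_comm' (t' := Finset.univ) (s' := fun j => Finset.Iio j)
      (by simp)]
    refine Finset.sum_le_sum fun j _ => ?_
    split_ifs
    · refine le_trans (Finset.sum_le_sum fun i hi => le_of_eq ?_)
        (hV.sum_le (Finset.Iio j) (fun i : Fin N => (j : ℕ) - i) ?_ _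
          (range_nonneg P lam (A + 2 * R + lam) c₀ c₁ ω j))
      · rw [Nat.cast_sub (show (i : ℕ) ≤ j from (Finset.mem_Iio.1 hi).le)]
      · intro i hi i' hi' he
        simp at hi hi' he
        ext; omega
    · simp
  · refine le_trans ?_ (hV.sum_pairs_le (N := N) c₀)
    rw [Finset.sum_filter]
    refine Finset.sum_le_sum fun i _ => ?_
    by_cases hi : (i : ℕ) < c₀
    · simp only [hi, true_and, if_true]
      rw [← Finset.sum_filter]
      refine Finset.sum_le_sum_of_subset_of_nonneg (fun j hj => ?_) fun _ _ _ => hpos _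
      have := h.cuts_le
      simp at hj ⊢
      omega
    · simp [hi]

theorem springEnergy_le {γ : ℝ} (hγ : 0 ≤ γ) {p p' : ℕ → ℝ}
    (h : Surgery D P lam R A s ℓ ℓ' c₀ c₁ ω ω') (hp : ∀ j < N, |p j - (P + j * lam)| ≤ R)
    (hp' : ∀ j < N, |p' j - (P + j * lam)| ≤ R) (hl : ∀ j < c₀, p' j = p j)
    (hr : ∀ j, c₁ ≤ j → p' j = p j + s) :
    springEnergy γ p' ω' - springEnergy γ p ω ≤
      ∑ j : Fin N with c₀ ≤ j.val ∧ j.val < c₁,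
        (6 * γ * (A + 2 * R + lam) * gap lam (A + 2 * R + lam) c₀ c₁ j
          + γ * (3 * lam ^ 2 + 4 * R ^ 2) - γ / 2 * ((ω j).1 - (P + j * lam)) ^ 2) := by
  have hB : 0 ≤ A + 2 * R + lam := by linarith [h.A_nonneg, h.R_nonneg, h.lam_pos]
  unfold springEnergy
  rw [← mul_sub, ← Finset.sum_sub_distrib, Finset.mul_sum, Finset.sum_filter]
  refine Finset.sum_le_sum fun j _ => ?_
  split_ifs with hj
  · obtain ⟨hq1, hq2⟩ := h.mid_Icc j hj.1 hj.2
    have hg := gap_le h.lam_pos hB hj.1 hj.2.le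
    have hg0 := gap_nonneg lam (A + 2 * R + lam) c₀ c₁ j
    have hq := abs_squeezed_sub_le (P := P) (lam := lam) (B := A + 2 * R + lam) (c₀ := c₀)
      (c₁ := c₁) j
    have h1 := hp j j.2
    have h2 := hp' j j.2
    have hlam := h.lam_pos
    have hR := h.R_nonneg
    set q := squeezed P lam (A + 2 * R + lam) c₀ c₁ j
    set a := P + (j : ℝ) * lam
    set x := (ω j).1
    set x' := (ω' j).1
    set gp := gap lam (A + 2 * R + lam) c₀ c₁ j
    have e1 : (q - a) ^ 2 ≤ 2 * (A + 2 * R + lam) * gp := by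
      have : (q - a) ^ 2 ≤ gp ^ 2 := sq_le_sq' (abs_le.1 hq).1 (abs_le.1 hq).2
      nlinarith
    have e2 : (p j - a) ^ 2 ≤ R ^ 2 := sq_le_sq' (abs_le.1 h1).1 (abs_le.1 h1).2
    have e3 : (p' j - a) ^ 2 ≤ R ^ 2 := sq_le_sq' (abs_le.1 h2).1 (abs_le.1 h2).2
    have e4 : (x' - q) ^ 2 ≤ lam ^ 2 := sq_le_sq' (by linarith) (by linarith)
    have e5 : (x' - p' j) ^ 2 ≤ 3 * ((x' - q) ^ 2 + (q - a) ^ 2 + (p' j - a) ^ 2) := by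
      nlinarith [sq_nonneg ((x' - q) - (q - a)), sq_nonneg ((x' - q) + (p' j - a)),
        sq_nonneg ((q - a) + (p' j - a))]
    have e6 : (x - a) ^ 2 / 2 ≤ (x - p j) ^ 2 + (p j - a) ^ 2 := by
      nlinarith [sq_nonneg ((x - p j) - (p j - a))]
    have : (x' - p' j) ^ 2 - (x - p j) ^ 2 ≤ 6 * (A + 2 * R + lam) * gp
        + (3 * lam ^ 2 + 4 * R ^ 2) - 1 / 2 * (x - a) ^ 2 := by linarith
    calc γ * ((x' - p' j) ^ 2 - (x - p j) ^ 2) ≤ γ * _ := mul_le_mul_of_nonneg_left this hγ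
      _ = _ := by ring
  · rcases lt_or_ge (j : ℕ) c₀ with hj0 | hj0
    · rw [h.left_eq j hj0, hl j hj0]; simp
    · have hj1 : c₁ ≤ (j : ℕ) := by omega
      rw [h.right_eq j hj1, hr j hj1]; simp

/-- Regularity and the buffers between the cuts and n keep the outer particles on the correct side
of u, so only middle particles spill. -/
theorem spill_le {n : ℕ} {u : ℝ} (h : Surgery D P lam R A s ℓ ℓ' c₀ c₁ ω ω')
    (hu : |u - (P + n * lam)| ≤ R) (hn₀ : c₀ ≤ n) (hn₁ : n ≤ c₁)
    (h₀ : c₀ = 0 ∨ A + R ≤ ((n : ℝ) - c₀) * lam)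
    (h₁ : c₁ = N ∨ A + R ≤ ((c₁ : ℝ) - n) * lam) :
    spill n u ω ≤ ∑ j : Fin N with c₀ ≤ j.val ∧ j.val < c₁,
      (|(ω j).1 - (P + j * lam)| + R) := by
  have hlam := h.lam_pos
  have hR := h.R_nonneg
  have hu' := abs_le.1 hu
  unfold spill
  rw [Finset.sum_filter]
  refine Finset.sum_le_sum fun j _ => ?_
  have hneg := neg_abs_le ((ω j).1 - (P + j * lam))
  have hle := le_abs_self ((ω j).1 - (P + j * lam))
  have habs := abs_nonneg ((ω j).1 - (P + j * lam))
  by_cases hj : c₀ ≤ (j : ℕ) ∧ (j : ℕ) < c₁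
  · rw [if_pos hj]
    split_ifs with hjn
    · have : (j : ℝ) * lam ≤ n * lam := by gcongr
      exact max_le (by linarith) (by linarith)
    · have : (n : ℝ) * lam ≤ j * lam := by gcongr; exact not_lt.1 hjn
      exact max_le (by linarith) (by linarith)
  · rw [if_neg hj]
    rcases lt_or_ge (j : ℕ) c₀ with hj0 | hj0
    · rw [if_pos (hj0.trans_le hn₀)]
      refine max_le ?_ le_rfl
      have h1 := h.left j hj0
      have h2 : (j : ℝ) * lam ≤ c₀ * lam := by gcongr
      rcases h₀ with h0 | h0
      · omega
      · linarith
    · have hj1 : c₁ ≤ (j : ℕ) := by omega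
      rw [if_neg (by omega)]
      refine max_le ?_ le_rfl
      have h1 := h.right j hj1
      have h2 : (c₁ : ℝ) * lam ≤ j * lam := by gcongr
      rcases h₁ with h0 | h0
      · omega
      · linarith

end Surgery

theorem card_filter_fin {N c₀ c₁ : ℕ} (h : c₁ ≤ N) :
    (Finset.univ.filter fun j : Fin N => c₀ ≤ j.val ∧ j.val < c₁).card = c₁ - c₀ := by
  rw [← Nat.card_Ico, ← Finset.card_map Fin.valEmbedding]
  congr 1
  ext m
  simp only [Finset.mem_map, Finset.mem_filter, Finset.mem_univ, true_and, Finset.mem_Ico,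
    Fin.valEmbedding_apply]
  exact ⟨by rintro ⟨j, hj, rfl⟩; exact hj, fun hm => ⟨⟨m, by omega⟩, hm, rfl⟩⟩

theorem sum_filter_fin {N c₀ c₁ : ℕ} (h : c₁ ≤ N) (f : ℕ → ℝ) :
    ∑ j : Fin N with c₀ ≤ j.val ∧ j.val < c₁, f j = ∑ j ∈ Finset.Ico c₀ c₁, f j := by
  have : Finset.Ico c₀ c₁ = (Finset.univ.filter fun j : Fin N => c₀ ≤ j.val ∧ j.val < c₁).map
      Fin.valEmbedding := by
    ext m
    simp only [Finset.mem_map, Finset.mem_filter, Finset.mem_univ, true_and, Finset.mem_Ico,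
      Fin.valEmbedding_apply]
    exact ⟨fun hm => ⟨⟨m, by omega⟩, hm, rfl⟩, by rintro ⟨j, hj, rfl⟩; exact hj⟩
  rw [this, Finset.sum_map]
  rfl

/-- The energy balance of a surgery. -/
theorem exists_energy_balance {D : CrossSection k} {V : Vec k → Vec k → ℝ → ℝ} {g : ℝ → ℝ}
    {κ G lam γ R τ : ℝ} (hV : PairBounds D V g κ (lam / 4) G) (hlam : 0 < lam) (hγ : 0 < γ)
    (hτ : 0 ≤ τ) :
    ∃ C₁ : ℝ, ∀ A : ℝ, ∃ C₂ : ℝ, ∀ {P s ℓ ℓ' u : ℝ} {c₀ c₁ n N : ℕ} {ω ω' : Fin N → ℝ × Vec k}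
      {p p' : ℕ → ℝ}, Surgery D P lam R A s ℓ ℓ' c₀ c₁ ω ω' →
      (∀ j < N, |p j - (P + j * lam)| ≤ R) → (∀ j < N, |p' j - (P + j * lam)| ≤ R) →
      (∀ j < c₀, p' j = p j) → (∀ j, c₁ ≤ j → p' j = p j + s) →
      |u - (P + n * lam)| ≤ R → c₀ ≤ n → n ≤ c₁ →
      (c₀ = 0 ∨ A + R ≤ ((n : ℝ) - c₀) * lam) → (c₁ = N ∨ A + R ≤ ((c₁ : ℝ) - n) * lam) →
      τ * spill n u ω - springEnergy γ p ω - pairEnergy V ω ≤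
        - springEnergy γ p' ω' - pairEnergy V ω' + C₂ + C₁ * ((c₁ - c₀ : ℕ) : ℝ)
        - 3 * γ / 8 * ∑ j : Fin N with c₀ ≤ j.val ∧ j.val < c₁, ((ω j).1 - (P + j * lam)) ^ 2 := by
  have hκ := hV.κ_nonneg
  have hG := hV.G_nonneg
  set m := τ + 2 * (κ + 1) * G with hm
  -- The rate per particle must not involve A, which is later chosen in terms of it. Here A enters
  -- only through factors of the gaps, whose total is bounded and goes into C₂.
  refine ⟨τ * R + 2 * (κ + 1) * G + γ * (3 * lam ^ 2 + 4 * R ^ 2) + 2 * m ^ 2 / γ, fun A => ?_⟩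
  obtain ⟨K, hK0, hK⟩ := exists_sum_gap_le (lam := lam) (B := A + 2 * R + lam) hlam
  refine ⟨(κ + 1) * G + (2 * (κ + 1) * G + 6 * γ * |A + 2 * R + lam|) * K, ?_⟩
  intro P s ℓ ℓ' u c₀ c₁ n N ω ω' p p' h hp hp' hl hr hu hn₀ hn₁ h₀ h₁
  have hB : 0 ≤ A + 2 * R + lam := by linarith [h.A_nonneg, h.R_nonneg, h.lam_pos]
  rw [abs_of_nonneg hB]
  have e1 := h.pairEnergy_le hV
  have e2 := h.springEnergy_le hγ.le hp hp' hl hr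
  have e3 := mul_le_mul_of_nonneg_left (h.spill_le hu hn₀ hn₁ h₀ h₁) hτ
  have hKN := mul_le_mul_of_nonneg_left (hK N c₀ c₁)
    (show 0 ≤ 2 * (κ + 1) * G + 6 * γ * (A + 2 * R + lam) by positivity)
  rw [← card_filter_fin (c₀ := c₀) h.le_card]
  have key : τ * ∑ j : Fin N with c₀ ≤ j.val ∧ j.val < c₁, (|(ω j).1 - (P + j * lam)| + R)
      + (κ + 1) * (2 * ∑ j : Fin N with c₀ ≤ j.val ∧ j.val < c₁,
        G * (1 + Surgery.range P lam (A + 2 * R + lam) c₀ c₁ ω j))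
      + ∑ j : Fin N with c₀ ≤ j.val ∧ j.val < c₁,
        (6 * γ * (A + 2 * R + lam) * gap lam (A + 2 * R + lam) c₀ c₁ j
          + γ * (3 * lam ^ 2 + 4 * R ^ 2) - γ / 2 * ((ω j).1 - (P + j * lam)) ^ 2)
      ≤ ∑ j : Fin N with c₀ ≤ j.val ∧ j.val < c₁,
        ((τ * R + 2 * (κ + 1) * G + γ * (3 * lam ^ 2 + 4 * R ^ 2) + 2 * m ^ 2 / γ)
          + (2 * (κ + 1) * G + 6 * γ * (A + 2 * R + lam)) * gap lam (A + 2 * R + lam) c₀ c₁ j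
          - 3 * γ / 8 * ((ω j).1 - (P + j * lam)) ^ 2) := by
    rw [← mul_assoc, Finset.mul_sum, Finset.mul_sum, ← Finset.sum_add_distrib,
      ← Finset.sum_add_distrib]
    refine Finset.sum_le_sum fun j _ => ?_
    unfold Surgery.range
    set d := (ω j).1 - (P + j * lam)
    -- All terms linear in the displacement are absorbed by a quarter of the available γ/2 d²,
    -- leaving 3γ/8.
    have hd : m * |d| ≤ γ / 8 * d ^ 2 + 2 * m ^ 2 / γ := by
      have h1 : 2 * m ^ 2 / γ = γ / 8 * (4 * m / γ) ^ 2 := by field_simp; ring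
      have h2 : m * |d| = γ / 8 * (2 * |d| * (4 * m / γ)) := by field_simp; ring
      rw [h1, h2, ← sq_abs d, ← mul_add]
      refine mul_le_mul_of_nonneg_left ?_ (by positivity)
      nlinarith [sq_nonneg (|d| - 4 * m / γ)]
    rw [hm] at hd ⊢
    linarith
  have hsplit : ∀ (S : Finset (Fin N)) (C b c : ℝ) (f h : Fin N → ℝ),
      ∑ j ∈ S, (C + b * f j - c * h j) = C * S.card + b * ∑ j ∈ S, f j - c * ∑ j ∈ S, h j := by
    intro S C b c f h
    simp [Finset.sum_add_distrib, Finset.sum_sub_distrib, Finset.mul_sum, mul_comm]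
  rw [hsplit] at key
  linarith

/-! ### Existence of regular cuts -/

/-- Take the last regular c ≤ n - M. Each later cut e up to n - M is spoiled by some j with d_j > A
+ (e - j)μ. One j spoils at most (d_j - A)/μ cuts, and 4A(d_j - A) ≤ d_j², so a long irregular
stretch forces large squared displacements. -/
theorem exists_regular_cut (d : ℕ → ℝ) {A μ : ℝ} (hA : 0 < A) (hμ : 0 < μ) (n M : ℕ) :
    ∃ c ≤ n, (c = 0 ∨ c + M ≤ n) ∧ (∀ j < c, d j ≤ A + ((c : ℝ) - j) * μ) ∧
      4 * μ * A * ((n : ℝ) - M - c) ≤ ∑ j ∈ Finset.Ico c n, d j ^ 2 := by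
  classical
  set Q : ℕ → Prop := fun c => ∀ j < c, d j ≤ A + ((c : ℝ) - j) * μ with hQ
  set c := Nat.findGreatest Q (n - M) with hc
  have hQc : Q c := Nat.findGreatest_spec (P := Q) (Nat.zero_le _) (by intro j hj; omega)
  have hcle : c ≤ n - M := Nat.findGreatest_le _
  refine ⟨c, by omega, by omega, hQc, ?_⟩
  have hbad : ∀ e ∈ Finset.Ioc c (n - M), ∃ j ∈ Finset.Ico c n,
      j < e ∧ A + ((e : ℝ) - j) * μ < d j := by
    intro e he
    rw [Finset.mem_Ioc] at he
    have : ¬ Q e := Nat.findGreatest_is_greatest he.1 he.2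
    simp only [hQ] at this
    push Not at this
    obtain ⟨j, hje, hj⟩ := this
    -- The culprit lies at or beyond c: a smaller j would satisfy the stricter bound belonging to
    -- the regular cut c.
    refine ⟨j, Finset.mem_Ico.2 ⟨?_, by omega⟩, hje, hj⟩
    by_contra! hjc
    have h1 := hQc j hjc
    have h2 : ((c : ℝ) - j) * μ ≤ ((e : ℝ) - j) * μ := by
      have : (c : ℝ) ≤ e := by exact_mod_cast he.1.le
      gcongr
    linarith
  choose! w hw using hbad
  have hcard := Finset.card_eq_sum_card_fiberwise (f := w) (s := Finset.Ioc c (n - M))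
    (t := Finset.Ico c n) fun e he => (hw e he).1
  have hle : (n : ℝ) - M - c ≤ ((Finset.Ioc c (n - M)).card : ℝ) := by
    rw [Nat.card_Ioc, sub_sub, sub_le_iff_le_add]
    norm_cast
    omega
  refine (mul_le_mul_of_nonneg_left hle (by positivity)).trans ?_
  rw [hcard, Nat.cast_sum, Finset.mul_sum]
  refine Finset.sum_le_sum fun j _ => ?_
  rcases (Finset.filter (fun e => w e = j) (Finset.Ioc c (n - M))).eq_empty_or_nonempty with h | h
  · rw [h]; simp; positivity
  -- All cuts spoiled by j lie between j and the largest of them, for which the violation bounds the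
  -- length of that interval.
  · obtain ⟨e, he, hmax⟩ := Finset.exists_max_image _ id h
    rw [Finset.mem_filter] at he
    have hwe := hw e he.1
    rw [he.2] at hwe
    have hsub : Finset.filter (fun e => w e = j) (Finset.Ioc c (n - M)) ⊆ Finset.Ioc j e := by
      intro e' he'
      have h1 := hmax e' he'
      rw [Finset.mem_filter] at he'
      have h2 := (hw e' he'.1).2.1
      rw [he'.2] at h2
      exact Finset.mem_Ioc.2 ⟨h2, h1⟩
    have h3 := Finset.card_le_card hsub
    rw [Nat.card_Ioc] at h3
    have h4 : ((Finset.filter (fun e => w e = j) (Finset.Ioc c (n - M))).card : ℝ) ≤ e - j := by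
      rw [le_sub_iff_add_le]
      have := hwe.2.1
      norm_cast
      omega
    have h5 := mul_le_mul_of_nonneg_right h4 hμ.le
    have h6 : 4 * A * ((((Finset.filter (fun e => w e = j)
        (Finset.Ioc c (n - M))).card : ℝ)) * μ) ≤ 4 * A * (d j - A) :=
      mul_le_mul_of_nonneg_left (by linarith [hwe.2.2]) (by positivity)
    nlinarith [sq_nonneg (d j - 2 * A)]

theorem exists_regular_cuts (d : ℕ → ℝ) {A μ : ℝ} (hA : 0 < A) (hμ : 0 < μ) {n N : ℕ} (hn : n ≤ N)
    (M : ℕ) :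
    ∃ c₀ c₁, c₀ ≤ n ∧ n ≤ c₁ ∧ c₁ ≤ N ∧ (c₀ = 0 ∨ c₀ + M ≤ n) ∧ (c₁ = N ∨ n + M ≤ c₁) ∧
      (∀ j < c₀, d j ≤ A + ((c₀ : ℝ) - j) * μ) ∧
      (∀ j, c₁ ≤ j → j < N → - A - ((j : ℝ) + 1 - c₁) * μ ≤ d j) ∧
      4 * μ * A * (((c₁ - c₀ : ℕ) : ℝ) - 2 * M) ≤ ∑ j ∈ Finset.Ico c₀ c₁, d j ^ 2 := by
  obtain ⟨c₀, h1, h2, h3, h4⟩ := exists_regular_cut d hA hμ n M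
  -- The right cut comes from the reflection j ↦ N - 1 - j of labels, under which cuts become N - c;
  -- hence the extra 1 in the bound on the right.
  obtain ⟨c, h1', h2', h3', h4'⟩ := exists_regular_cut (fun j => - d (N - 1 - j)) hA hμ (N - n) M
  refine ⟨c₀, N - c, h1, by omega, by omega, h2, by omega, h3, fun j hj hjN => ?_, ?_⟩
  · have := h3' (N - 1 - j) (by omega)
    rw [show N - 1 - (N - 1 - j) = j by omega, Nat.cast_sub (by omega), Nat.cast_sub (by omega)]
      at this
    rw [Nat.cast_sub (by omega)]
    push_cast at this
    linarith
  · have hsum := Finset.sum_Ico_consecutive (fun j => d j ^ 2) h1 (show n ≤ N - c by omega)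
    rw [← hsum]
    have hrefl : ∑ j ∈ Finset.Ico c (N - n), (- d (N - 1 - j)) ^ 2
        = ∑ j ∈ Finset.Ico n (N - c), d j ^ 2 := by
      rcases Nat.eq_zero_or_pos N with rfl | hN
      · simp
      · have := Finset.sum_Ico_reflect (fun j => d j ^ 2) c (m := N - n) (n := N - 1) (by omega)
        rw [show N - 1 + 1 - (N - n) = n by omega, show N - 1 + 1 - c = N - c by omega] at this
        rw [← this]
        simp
    rw [hrefl, Nat.cast_sub hn] at h4'
    rw [Nat.cast_sub (by omega), Nat.cast_sub (by omega)]
    linarith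

end Jellium

/-! ### Integration over replaced coordinates, measurability -/

namespace Jellium

open scoped ENNReal

theorem lmarginal_prod {ι E : Type*} [DecidableEq ι] [MeasureSpace E]
    [SigmaFinite (volume : Measure E)] (S : Finset ι) (w : ι → E → ℝ≥0∞)
    (hw : ∀ i, Measurable (w i)) (x : ι → E) :
    lmarginal (fun _ => (volume : Measure E)) S (fun ω => ∏ i ∈ S, w i (ω i)) x
      = ∏ i ∈ S, ∫⁻ z, w i z := by
  induction S using Finset.induction_on with
  | empty => simp
  | insert i S hi ih =>
    have hm : Measurable fun ω : ι → E => ∏ i ∈ S, w i (ω i) := by fun_prop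
    have hm' : Measurable fun ζ : S → E => ∏ i ∈ S, w i (Function.updateFinset x S ζ i) :=
      hm.comp measurable_updateFinset
    rw [lmarginal_insert' _ (by fun_prop) hi, Finset.prod_insert hi, ← ih]
    simp only [lmarginal]
    rw [← lintegral_const_mul _ hm']
    refine lintegral_congr fun y => ?_
    have : ∀ z : E, ∏ j ∈ insert i S, w j (Function.update (Function.updateFinset x S y) i z j)
        = w i z * ∏ j ∈ S, w j (Function.updateFinset x S y j) := by
      intro z
      rw [Finset.prod_insert hi, Function.update_self]
      congr 1
      refine Finset.prod_congr rfl fun j hj => ?_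
      rw [Function.update_of_ne (by rintro rfl; exact hi hj)]
    simp only [this]
    rw [lintegral_mul_const _ (hw i)]

/-- Comparison of two integrals when the coordinates in `S` are replaced. -/
theorem lintegral_le_of_replace {ι E : Type*} [Fintype ι] [DecidableEq ι] [MeasureSpace E]
    [SigmaFinite (volume : Measure E)] (S : Finset ι) {f F : (ι → E) → ℝ≥0∞} (hf : Measurable f)
    (hF : Measurable F) {w : ι → E → ℝ≥0∞} (hw : ∀ i, Measurable (w i)) {B : ι → Set E}
    (hBm : ∀ i, MeasurableSet (B i))
    {a b Q : ℝ≥0∞} (ha : ∀ i, ∫⁻ z, w i z = a) (hb : ∀ i, volume (B i) = b) (hb0 : b ≠ 0)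
    (hbt : b ≠ ∞)
    (h : ∀ ω ω' : ι → E, (∀ i ∉ S, ω' i = ω i) → (∀ i ∈ S, ω' i ∈ B i) →
      f ω ≤ Q * (∏ i ∈ S, w i (ω i)) * F ω') :
    ∫⁻ ω, f ω ≤ Q * (a / b) ^ S.card * ∫⁻ ω, F ω := by
  rw [← lintegral_const_mul _ hF]
  refine lintegral_le_of_lmarginal_le (μ := fun _ : ι => (volume : Measure E)) S hf
    (hF.const_mul _) fun x => ?_
  have hprod := lmarginal_prod S w hw x
  have hm : Measurable fun ω : ι → E => ∏ i ∈ S, w i (ω i) := by fun_prop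
  have hm' : Measurable fun ζ : S → E => ∏ i ∈ S, w i (Function.updateFinset x S ζ i) :=
    hm.comp measurable_updateFinset
  have hF' : Measurable fun ζ : S → E => F (Function.updateFinset x S ζ) :=
    hF.comp measurable_updateFinset
  -- The bound holds for every new position in the box, so the old coordinates can be integrated out
  -- first with ζ' fixed; averaging over the box then produces b to the power of the number of
  -- coordinates.
  have key : ∀ ζ' ∈ Set.pi univ (fun i : S => B i),
      lmarginal (fun _ => (volume : Measure E)) S f x
        ≤ Q * a ^ S.card * F (Function.updateFinset x S ζ') := by
    intro ζ' hζ'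
    calc lmarginal (fun _ => (volume : Measure E)) S f x
        ≤ ∫⁻ ζ : (∀ i : S, E), Q * F (Function.updateFinset x S ζ') *
            ∏ i ∈ S, w i (Function.updateFinset x S ζ i) ∂Measure.pi fun _ => volume := by
          refine lintegral_mono fun ζ => (h _ (Function.updateFinset x S ζ') ?_ ?_).trans_eq ?_
          · intro i hi; simp [Function.updateFinset, hi]
          · intro i hi; simpa [Function.updateFinset, hi] using hζ' ⟨i, hi⟩ (mem_univ _)
          · ring
      _ = Q * F (Function.updateFinset x S ζ') * ∏ i ∈ S, ∫⁻ z, w i z := by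
          rw [lintegral_const_mul _ hm', ← hprod, lmarginal]
      _ = _ := by simp only [ha, Finset.prod_const]; ring
  have hvol : (Measure.pi fun _ : S => (volume : Measure E)) (Set.pi univ (fun i : S => B i))
      = b ^ S.card := by
    rw [Measure.pi_pi]; simp [hb]
  have hmul : lmarginal (fun _ => (volume : Measure E)) S f x * b ^ S.card ≤
      Q * a ^ S.card * lmarginal (fun _ => (volume : Measure E)) S F x := by
    rw [← hvol, ← setLIntegral_const]
    refine (setLIntegral_mono' (MeasurableSet.univ_pi (t := fun i : S => B i) fun i => hBm i) key).trans ?_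
    refine (setLIntegral_le_lintegral _ _).trans_eq ?_
    rw [lintegral_const_mul _ hF']
    rfl
  have hpow0 : b ^ S.card ≠ 0 := pow_ne_zero _ hb0
  have hpowt : b ^ S.card ≠ ∞ := ENNReal.pow_ne_top hbt
  rw [← ENNReal.le_div_iff_mul_le (.inl hpow0) (.inl hpowt)] at hmul
  refine hmul.trans_eq ?_
  rw [show lmarginal (fun _ => (volume : Measure E)) S
      (fun ω => Q * (a / b) ^ S.card * F ω) x = Q * (a / b) ^ S.card *
        lmarginal (fun _ => (volume : Measure E)) S F x from
      lintegral_const_mul _ hF']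
  rw [div_eq_mul_inv, div_eq_mul_inv, mul_pow, ENNReal.inv_pow]
  ring

theorem sum_half_pow_le {F : Finset ℕ} {f : ℕ → ℕ} (hf : Set.InjOn f F) :
    ∑ i ∈ F, (2⁻¹ : ℝ≥0∞) ^ f i ≤ 2 := by
  rw [← Finset.sum_image (f := fun m => (2⁻¹ : ℝ≥0∞) ^ m) hf]
  refine (ENNReal.sum_le_tsum _).trans_eq ?_
  rw [ENNReal.tsum_geometric, ENNReal.one_sub_inv_two, inv_inv]

variable {k : ℕ}

theorem measurableSet_carrier (D : CrossSection k) : MeasurableSet D.carrier :=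
  D.isCompact_carrier.measurableSet

theorem measurableSet_configs (D : CrossSection k) (N : ℕ) (ℓ ℓ' : ℝ) :
    MeasurableSet (configs D N ℓ ℓ') := by
  have hD := measurableSet_carrier D
  have : configs D N ℓ ℓ' = (⋂ j, {ω | (ω j).1 ∈ Ioo ℓ ℓ'} ∩ {ω | (ω j).2 ∈ D.carrier}) ∩
      ⋂ i, ⋂ j, {ω | i < j → (ω i).1 < (ω j).1} := by
    ext ω
    simp only [configs, StrictMono, mem_ofPred_eq, mem_inter_iff, mem_iInter]
  rw [this]
  refine (MeasurableSet.iInter fun j => ?_).inter (.iInter fun i => .iInter fun j => ?_)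
  · exact (measurableSet_Ioo.preimage (by fun_prop)).inter (hD.preimage (by fun_prop))
  · exact (MeasurableSet.const _).imp (measurableSet_lt (by fun_prop) (by fun_prop))

/-- The Boltzmann weight of a configuration with springs at the positions `p`. -/
noncomputable def weight (D : CrossSection k) (V : Vec k → Vec k → ℝ → ℝ) (γ : ℝ) (p : ℕ → ℝ)
    (ℓ ℓ' : ℝ) {N : ℕ} : (Fin N → ℝ × Vec k) → ℝ≥0∞ :=
  (configs D N ℓ ℓ').indicator fun ω =>
    ENNReal.ofReal (Real.exp (-springEnergy γ p ω - pairEnergy V ω))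

theorem measurable_springEnergy (γ : ℝ) (p : ℕ → ℝ) {N : ℕ} :
    Measurable (springEnergy γ p : (Fin N → ℝ × Vec k) → ℝ) := by
  unfold springEnergy; fun_prop

theorem measurable_pairEnergy {V : Vec k → Vec k → ℝ → ℝ}
    (hV : Measurable fun q : Vec k × Vec k × ℝ => V q.1 q.2.1 q.2.2) {N : ℕ} :
    Measurable (pairEnergy V : (Fin N → ℝ × Vec k) → ℝ) := by
  unfold pairEnergy
  refine Finset.measurable_fun_sum _ fun i _ => Finset.measurable_fun_sum _ fun j _ => ?_
  exact hV.comp (g := fun q : Vec k × Vec k × ℝ => V q.1 q.2.1 q.2.2)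
    (f := fun ω : Fin N → ℝ × Vec k => ((ω i).2, (ω j).2, |(ω i).1 - (ω j).1|)) (by
      refine Measurable.prodMk (by fun_prop) (Measurable.prodMk (by fun_prop) ?_)
      exact (Measurable.sub (by fun_prop) (by fun_prop)).abs)

theorem measurable_weight (D : CrossSection k) {V : Vec k → Vec k → ℝ → ℝ}
    (hV : Measurable fun q : Vec k × Vec k × ℝ => V q.1 q.2.1 q.2.2) (γ : ℝ) (p : ℕ → ℝ)
    (ℓ ℓ' : ℝ) {N : ℕ} : Measurable (weight D V γ p ℓ ℓ' (N := N)) := by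
  refine Measurable.indicator ?_ (measurableSet_configs D N ℓ ℓ')
  exact (Real.measurable_exp.comp ((measurable_springEnergy γ p).neg.sub
    (measurable_pairEnergy hV))).ennreal_ofReal

theorem measurable_spill (n : ℕ) (u : ℝ) {N : ℕ} :
    Measurable (spill n u : (Fin N → ℝ × Vec k) → ℝ) := by
  unfold spill
  refine Finset.measurable_fun_sum _ fun j _ => ?_
  split_ifs
  · exact Measurable.max (by fun_prop) measurable_const
  · exact Measurable.max (by fun_prop) measurable_const

end Jellium

/-! ### Comparison of partition functions under a rigid shift -/

namespace Jellium

open scoped ENNReal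

variable {k : ℕ}

theorem volume_carrier_ne_zero (D : CrossSection k) : volume D.carrier ≠ 0 := D.volume_pos.ne'

theorem volume_carrier_ne_top (D : CrossSection k) : volume D.carrier ≠ ∞ :=
  D.isCompact_carrier.measure_lt_top.ne

/-- A Gaussian density in the first coordinate, uniform in the cross-section. -/
noncomputable def bump (D : CrossSection k) (b c : ℝ) (z : ℝ × Vec k) : ℝ≥0∞ :=
  ENNReal.ofReal (Real.exp (-b * (z.1 - c) ^ 2)) * D.carrier.indicator 1 z.2

theorem measurable_bump (D : CrossSection k) (b c : ℝ) : Measurable (bump D b c) := by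
  unfold bump
  refine Measurable.mul (by fun_prop) ?_
  exact (measurable_one.indicator (measurableSet_carrier D)).comp measurable_snd

theorem lintegral_bump (D : CrossSection k) (b c : ℝ) :
    ∫⁻ z, bump D b c z
      = (∫⁻ x : ℝ, ENNReal.ofReal (Real.exp (-b * x ^ 2))) * volume D.carrier := by
  rw [Measure.volume_eq_prod]
  unfold bump
  rw [lintegral_prod_mul (f := fun x : ℝ => ENNReal.ofReal (Real.exp (-b * (x - c) ^ 2)))
    (g := D.carrier.indicator 1) (by fun_prop)
    (measurable_one.indicator (measurableSet_carrier D)).aemeasurable,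
    lintegral_indicator_one (measurableSet_carrier D)]
  congr 1
  exact lintegral_sub_right_eq_self (fun x : ℝ => ENNReal.ofReal (Real.exp (-b * x ^ 2))) c

theorem lintegral_gaussian_ne_top {b : ℝ} (hb : 0 < b) :
    ∫⁻ x : ℝ, ENNReal.ofReal (Real.exp (-b * x ^ 2)) ≠ ∞ := by
  rw [← ofReal_integral_eq_lintegral_ofReal (integrable_exp_neg_mul_sq hb)
    (.of_forall fun x => (Real.exp_pos _).le)]
  exact ENNReal.ofReal_ne_top

/-- The configurations with regular cuts at `c₀ ≤ n ≤ c₁` between which the particles are far from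
their lattice sites. -/
def piece (P lam A : ℝ) (M n N c₀ c₁ : ℕ) : Set (Fin N → ℝ × Vec k) :=
  {ω | ((c₀ = 0 ∨ c₀ + M ≤ n) ∧ (c₁ = N ∨ n + M ≤ c₁)) ∧
    (∀ j : Fin N, (j : ℕ) < c₀ →
      (ω j).1 ≤ P + c₀ * lam + (A + lam / 2) - ((c₀ : ℝ) - j) * (lam / 2)) ∧
    (∀ j : Fin N, c₁ ≤ (j : ℕ) →
      P + c₁ * lam - (A + lam / 2) + ((j : ℝ) - c₁) * (lam / 2) ≤ (ω j).1) ∧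
    2 * lam * A * (((c₁ - c₀ : ℕ) : ℝ) - 2 * M)
      ≤ ∑ j : Fin N with c₀ ≤ j.val ∧ j.val < c₁, ((ω j).1 - (P + j * lam)) ^ 2}

theorem measurableSet_piece (P lam A : ℝ) (M n N c₀ c₁ : ℕ) :
    MeasurableSet (piece P lam A M n N c₀ c₁ : Set (Fin N → ℝ × Vec k)) := by
  refine (MeasurableSet.const _).inter (.inter ?_ (.inter ?_ ?_))
  · change MeasurableSet {ω : Fin N → ℝ × Vec k | ∀ j : Fin N, (j : ℕ) < c₀ → (ω j).1 ≤ _}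
    rw [ofPred_forall]
    exact .iInter fun j => (MeasurableSet.const _).imp (measurableSet_le (by fun_prop) (by fun_prop))
  · change MeasurableSet {ω : Fin N → ℝ × Vec k | ∀ j : Fin N, c₁ ≤ (j : ℕ) → _ ≤ (ω j).1}
    rw [ofPred_forall]
    exact .iInter fun j => (MeasurableSet.const _).imp (measurableSet_le (by fun_prop) (by fun_prop))
  · exact measurableSet_le (f := fun _ : Fin N → ℝ × Vec k => _) (g := fun ω => ∑ j : Fin N with
      c₀ ≤ j.val ∧ j.val < c₁, ((ω j).1 - (P + j * lam)) ^ 2) measurable_const (by fun_prop)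

theorem exists_mem_piece {P lam A : ℝ} (hlam : 0 < lam) (hA : 0 < A) {n N : ℕ} (hn : n ≤ N)
    (M : ℕ) (ω : Fin N → ℝ × Vec k) :
    ∃ c₀ ∈ Finset.range (n + 1), ∃ c₁ ∈ Finset.Icc n N, ω ∈ piece P lam A M n N c₀ c₁ := by
  obtain ⟨c₀, c₁, h0, h1, h1N, h2, h3, h4, h5, h6⟩ := exists_regular_cuts
    (fun j => if h : j < N then (ω ⟨j, h⟩).1 - (P + j * lam) else 0) hA (half_pos hlam) hn M
  refine ⟨c₀, Finset.mem_range.2 (by omega), c₁, Finset.mem_Icc.2 ⟨h1, h1N⟩, ⟨h2, h3⟩,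
    fun j hj => ?_, fun j hj => ?_, ?_⟩
  · have := h4 j hj
    rw [dif_pos j.2] at this
    linarith
  · have := h5 j hj j.2
    rw [dif_pos j.2] at this
    linarith
  · rw [← sum_filter_fin h1N] at h6
    simp only [Fin.is_lt, dite_true] at h6
    linarith

theorem isAddRightInvariant_volume_fin_prod (N : ℕ) :
    (volume : Measure (Fin N → ℝ × Vec k)).IsAddRightInvariant := by
  have : (volume : Measure (ℝ × Vec k)).IsAddLeftInvariant := by
    rw [Measure.volume_eq_prod]; infer_instance
  have : (volume : Measure (Fin N → ℝ × Vec k)).IsAddLeftInvariant :=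
    Pi.isAddLeftInvariant_volume
  infer_instance

/-- The configurations are decomposed by their regular cuts; on each piece the replacement of the
middle particles loses a factor r per particle from entropy and gains more from the stretched
springs. C and M do not depend on the size or location of the system. -/
theorem exists_surgery {D : CrossSection k} {V : Vec k → Vec k → ℝ → ℝ} {g : ℝ → ℝ}
    {κ G lam γ R τ : ℝ} (hV : PairBounds D V g κ (lam / 4) G)
    (hVm : Measurable fun q : Vec k × Vec k × ℝ => V q.1 q.2.1 q.2.2)
    (hlam : 0 < lam) (hγ : 0 < γ) (hτ : 0 ≤ τ) (hR : 0 ≤ R) :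
    ∃ C : ℝ, 0 ≤ C ∧ ∃ M : ℕ, ∀ {P s ℓ ℓ' u : ℝ} {n N : ℕ} {p p' : ℕ → ℝ}, M ≤ N → n ≤ N →
      |ℓ - P| ≤ R → |ℓ' - (P + N * lam)| ≤ R → |ℓ' + s - (P + N * lam)| ≤ R →
      (∀ j < N, |p j - (P + j * lam)| ≤ R) → (∀ j < N, |p' j - (P + j * lam)| ≤ R) →
      (∀ j < n, p' j = p j) → (∀ j, n ≤ j → p' j = p j + s) →
      |u - (P + n * lam)| ≤ R →
      ∫⁻ ω : Fin N → ℝ × Vec k, ENNReal.ofReal (Real.exp (τ * spill n u ω)) *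
        weight D V γ p ℓ ℓ' ω ≤
        ENNReal.ofReal C * ∫⁻ ω : Fin N → ℝ × Vec k, weight D V γ p' ℓ (ℓ' + s) ω := by
  obtain ⟨C₁, hC₁⟩ := exists_energy_balance (R := R) hV hlam hγ hτ
  set a : ℝ≥0∞ := (∫⁻ x : ℝ, ENNReal.ofReal (Real.exp (-(γ / 8) * x ^ 2))) * volume D.carrier
    with ha
  set b : ℝ≥0∞ := ENNReal.ofReal (lam / 4) * volume D.carrier with hb
  have hat : a ≠ ∞ := ENNReal.mul_ne_top (lintegral_gaussian_ne_top (by positivity))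
    (volume_carrier_ne_top D)
  have hb0 : b ≠ 0 := mul_ne_zero (by simpa using hlam) (volume_carrier_ne_zero D)
  have hbt : b ≠ ∞ := ENNReal.mul_ne_top ENNReal.ofReal_ne_top (volume_carrier_ne_top D)
  have habt : a / b ≠ ∞ := ENNReal.div_ne_top hat hb0
  set r : ℝ := (a / b).toReal with hr
  have hr0 : 0 ≤ r := ENNReal.toReal_nonneg
  -- Chosen so that γ/4 of the squared displacements pays the energy rate C₁ and leaves 2r + 1 per
  -- particle against the entropy factor r.
  set A : ℝ := (|C₁| + (2 * r + 1)) / (γ / 4 * (2 * lam)) with hA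
  have hApos : 0 < A := by positivity
  have hAeq : γ / 4 * (2 * lam * A) = |C₁| + (2 * r + 1) := by rw [hA]; field_simp
  obtain ⟨C₂, hC₂⟩ := hC₁ (A + lam / 2)
  set M : ℕ := ⌈4 * ((A + lam / 2) + 2 * R + lam) / lam⌉₊ with hM
  have hMlam : 4 * ((A + lam / 2) + 2 * R + lam) ≤ M * lam := by
    rw [← div_le_iff₀ hlam]; exact Nat.le_ceil _
  set C₃ : ℝ := C₂ + γ / 4 * (2 * lam * A) * (2 * M) with hC₃
  refine ⟨Real.exp C₃ * 4, by positivity, M, ?_⟩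
  intro P s ℓ ℓ' u n N p p' hMN hn hℓ hℓ' hℓs hp hp' hl hri hu
  set f : (Fin N → ℝ × Vec k) → ℝ≥0∞ := fun ω => ENNReal.ofReal (Real.exp (τ * spill n u ω)) *
        weight D V γ p ℓ ℓ' ω with hf
  have hfm : Measurable f := by
    refine Measurable.mul ?_ (measurable_weight D hVm γ p ℓ ℓ')
    exact (Real.measurable_exp.comp ((measurable_spill n u).const_mul τ)).ennreal_ofReal
  have hpiece : ∀ c₀ ∈ Finset.range (n + 1), ∀ c₁ ∈ Finset.Icc n N,
      ∫⁻ ω, (piece P lam A M n N c₀ c₁).indicator f ω ≤ ENNReal.ofReal (Real.exp C₃) *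
        (2⁻¹ ^ (n - c₀) * 2⁻¹ ^ (c₁ - n)) * ∫⁻ ω : Fin N → ℝ × Vec k,
          weight D V γ p' ℓ (ℓ' + s) ω := by
    intro c₀ hc₀ c₁ hc₁
    rw [Finset.mem_range] at hc₀
    rw [Finset.mem_Icc] at hc₁
    set S : Finset (Fin N) := Finset.univ.filter fun j : Fin N => c₀ ≤ j.val ∧ j.val < c₁ with hS
    have hScard : S.card = c₁ - c₀ := card_filter_fin hc₁.2
    -- The rigid translation of the right block is split off by invariance of Lebesgue measure, so
    -- that only the coordinates in S are replaced.
    set v : Fin N → ℝ × Vec k := fun j => if c₁ ≤ (j : ℕ) then (s, 0) else 0 with hv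
    have := isAddRightInvariant_volume_fin_prod (k := k) N
    rw [← lintegral_add_right_eq_self (fun ω : Fin N → ℝ × Vec k =>
      weight D V γ p' ℓ (ℓ' + s) ω) v]
    have hmain := lintegral_le_of_replace S (f := (piece P lam A M n N c₀ c₁).indicator f)
      (F := fun ω => weight D V γ p' ℓ (ℓ' + s) (ω + v))
      (w := fun j => bump D (γ / 8) (P + (j : ℕ) * lam))
      (B := fun j => Icc (squeezed P lam ((A + lam / 2) + 2 * R + lam) c₀ c₁ j)
        (squeezed P lam ((A + lam / 2) + 2 * R + lam) c₀ c₁ j + lam / 4) ×ˢ D.carrier)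
      (a := a) (b := b)
      (Q := ENNReal.ofReal (Real.exp (C₃ - (2 * r + 1) * ((c₁ - c₀ : ℕ) : ℝ))))
      (hfm.indicator (measurableSet_piece _ _ _ _ _ _ _ _))
      ((measurable_weight D hVm γ p' ℓ (ℓ' + s)).comp (measurable_add_const v))
      (fun j => measurable_bump D _ _)
      (fun j => measurableSet_Icc.prod (measurableSet_carrier D))
      (fun j => lintegral_bump D _ _) ?_ hb0 hbt ?_
    · refine hmain.trans (mul_le_mul_left ?_ _)
      rw [hScard, ← pow_add, show n - c₀ + (c₁ - n) = c₁ - c₀ by omega, sub_eq_add_neg,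
        Real.exp_add, ENNReal.ofReal_mul (Real.exp_pos _).le, mul_assoc]
      refine mul_le_mul_right ?_ _
      rw [← neg_mul, mul_comm (-(2 * r + 1)), Real.exp_nat_mul,
        ENNReal.ofReal_pow (Real.exp_pos _).le, ← mul_pow]
      refine pow_le_pow_left₀ (zero_le) ?_ _
      rw [← ENNReal.ofReal_toReal habt, ← hr, ← ENNReal.ofReal_mul (Real.exp_pos _).le,
        show (2⁻¹ : ℝ≥0∞) = ENNReal.ofReal 2⁻¹ by
          rw [ENNReal.ofReal_inv_of_pos (by norm_num)]; norm_num]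
      refine ENNReal.ofReal_le_ofReal ?_
      -- Since 2r ≤ exp(2r + 1), each middle particle contributes at most a factor 1/2.
      rw [Real.exp_neg, inv_mul_le_iff₀ (Real.exp_pos _)]
      linarith [Real.add_one_le_exp (2 * r + 1)]
    · intro j
      rw [Measure.volume_eq_prod, Measure.prod_prod, Real.volume_Icc, add_sub_cancel_left]
    · intro ω ω' hoff hon
      by_cases hω : ω ∈ piece P lam A M n N c₀ c₁
      swap
      · simp [hω]
      rw [indicator_of_mem hω]
      by_cases hmem : ω ∈ configs D N ℓ ℓ'
      swap
      · simp [hf, weight, hmem]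
      obtain ⟨⟨hw0, hw1⟩, hleft, hright, hbad⟩ := hω
      have hcard : (M : ℝ) ≤ (c₁ : ℝ) - c₀ := by
        rw [le_sub_iff_add_le]
        have : M + c₀ ≤ c₁ := by omega
        exact_mod_cast this
      have hsurg : Surgery D P lam R (A + lam / 2) s ℓ ℓ' c₀ c₁ ω (ω' + v) := by
        refine ⟨hlam, hR, by positivity, hℓ, hℓ', hℓs, hc₁.2, ?_, hmem, hleft, hright, ?_, ?_, ?_,
          ?_⟩
        · exact hMlam.trans (by gcongr)
        · intro j hj
          have hjS : j ∉ S := by simp [hS]; omega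
          have : ¬ c₁ ≤ (j : ℕ) := by omega
          simp [hv, this, hoff j hjS]
        · intro j hj
          have hjS : j ∉ S := by simp [hS]; omega
          ext <;> simp [hv, hj, hoff j hjS]
        · intro j hj hj'
          have := (hon j (by simp [hS, hj, hj'])).2
          simpa [hv, not_le.2 hj'] using this
        · intro j hj hj'
          have := (hon j (by simp [hS, hj, hj'])).1
          simpa only [hv, Pi.add_apply, not_le.2 hj', if_false, add_zero] using this
      have hAM : A + lam / 2 + R ≤ M * lam := by linarith
      have hbal := hC₂ hsurg hp hp' (fun j hj => hl j (by omega)) (fun j hj => hri j (by omega)) hu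
        (by omega) hc₁.1 (hw0.imp_right fun h => hAM.trans (by
          have : (M : ℝ) ≤ (n : ℝ) - c₀ := by
            rw [le_sub_iff_add_le, add_comm]; exact_mod_cast h
          gcongr))
        (hw1.imp_right fun h => hAM.trans (by
          have : (M : ℝ) ≤ (c₁ : ℝ) - n := by
            rw [le_sub_iff_add_le, add_comm]; exact_mod_cast h
          gcongr))
      have hbump : ∏ j ∈ S, bump D (γ / 8) (P + (j : ℕ) * lam) (ω j)
          = ENNReal.ofReal (Real.exp (-(γ / 8) * ∑ j ∈ S, ((ω j).1 - (P + j * lam)) ^ 2)) := by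
        rw [Finset.mul_sum, Real.exp_sum, ENNReal.ofReal_prod_of_nonneg
          fun j _ => (Real.exp_pos _).le]
        refine Finset.prod_congr rfl fun j _ => ?_
        simp [bump, (hmem.1 j).2]
      rw [hbump]
      simp only [hf, weight, indicator_of_mem hmem, indicator_of_mem hsurg.mem_configs]
      rw [← ENNReal.ofReal_mul (Real.exp_pos _).le, ← ENNReal.ofReal_mul (Real.exp_pos _).le,
        ← ENNReal.ofReal_mul (by positivity), ← Real.exp_add, ← Real.exp_add, ← Real.exp_add]
      refine ENNReal.ofReal_le_ofReal (Real.exp_le_exp.2 ?_)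
      -- The 3γ/8 of the energy balance is split: γ/4 is used here, and γ/8 remains as the Gaussian
      -- weight of the old positions.
      have h1 := mul_le_mul_of_nonneg_left hbad (show 0 ≤ γ / 4 by positivity)
      have h2 : C₁ * ((c₁ - c₀ : ℕ) : ℝ) ≤ |C₁| * ((c₁ - c₀ : ℕ) : ℝ) := by
        gcongr; exact le_abs_self _
      have h3 : γ / 4 * (2 * lam * A * (((c₁ - c₀ : ℕ) : ℝ) - 2 * M))
          = (|C₁| + (2 * r + 1)) * ((c₁ - c₀ : ℕ) : ℝ) - γ / 4 * (2 * lam * A) * (2 * M) := by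
        rw [← hAeq]; ring
      rw [h3] at h1
      rw [hC₃]
      linarith
  calc ∫⁻ ω, f ω ≤ ∫⁻ ω, ∑ c₀ ∈ Finset.range (n + 1), ∑ c₁ ∈ Finset.Icc n N,
        (piece P lam A M n N c₀ c₁).indicator f ω := by
        refine lintegral_mono fun ω => ?_
        obtain ⟨c₀, h0, c₁, h1, hmem⟩ := exists_mem_piece (P := P) hlam hApos hn M ω
        refine le_trans ?_ (Finset.single_le_sum (f := fun c₀ => ∑ c₁ ∈ Finset.Icc n N,
          (piece P lam A M n N c₀ c₁).indicator f ω) (fun _ _ => zero_le) h0)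
        refine le_trans ?_ (Finset.single_le_sum (f := fun c₁ =>
          (piece P lam A M n N c₀ c₁).indicator f ω) (fun _ _ => zero_le) h1)
        simp only [indicator_of_mem hmem, le_refl]
    _ = ∑ c₀ ∈ Finset.range (n + 1), ∑ c₁ ∈ Finset.Icc n N,
        ∫⁻ ω, (piece P lam A M n N c₀ c₁).indicator f ω := by
        have hm := fun c₀ c₁ => hfm.indicator (measurableSet_piece (k := k) P lam A M n N c₀ c₁)
        rw [lintegral_finsetSum _ fun c₀ _ => Finset.measurable_fun_sum _ fun c₁ _ => hm c₀ c₁]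
        exact Finset.sum_congr rfl fun c₀ _ => lintegral_finsetSum _ fun c₁ _ => hm c₀ c₁
    _ ≤ ∑ c₀ ∈ Finset.range (n + 1), ∑ c₁ ∈ Finset.Icc n N, ENNReal.ofReal (Real.exp C₃) *
        (2⁻¹ ^ (n - c₀) * 2⁻¹ ^ (c₁ - n)) * ∫⁻ ω : Fin N → ℝ × Vec k,
          weight D V γ p' ℓ (ℓ' + s) ω :=
        Finset.sum_le_sum fun c₀ h0 => Finset.sum_le_sum fun c₁ h1 => hpiece c₀ h0 c₁ h1
    _ = ENNReal.ofReal (Real.exp C₃) * ((∑ c₀ ∈ Finset.range (n + 1), 2⁻¹ ^ (n - c₀)) *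
        ∑ c₁ ∈ Finset.Icc n N, 2⁻¹ ^ (c₁ - n)) * ∫⁻ ω : Fin N → ℝ × Vec k,
          weight D V γ p' ℓ (ℓ' + s) ω := by
        simp only [Finset.sum_mul, Finset.mul_sum]
        exact Finset.sum_comm
    _ ≤ _ := by
        refine mul_le_mul_left ?_ _
        rw [ENNReal.ofReal_mul (Real.exp_pos _).le]
        refine mul_le_mul_right ?_ _
        calc _ ≤ (2 : ℝ≥0∞) * 2 := mul_le_mul' (sum_half_pow_le ?_) (sum_half_pow_le ?_)
          _ = _ := by rw [ENNReal.ofReal_ofNat]; norm_num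
        · intro i hi j hj h
          simp at hi hj h; omega
        · intro i hi j hj h
          simp at hi hj h; omega

end Jellium

/-! ### Exponential moments by tilting the springs -/

namespace Jellium

open scoped ENNReal

variable {k : ℕ}

theorem spill_nonneg (n : ℕ) (u : ℝ) {N : ℕ} (ω : Fin N → ℝ × Vec k) : 0 ≤ spill n u ω := by
  unfold spill
  refine Finset.sum_nonneg fun j _ => ?_
  split_ifs <;> exact le_max_right _ _

/-- A linear tilt of the springs in a window amounts to a shift of their rest positions. -/
theorem springEnergy_tilt {γ : ℝ} (hγ : 0 < γ) (p : ℕ → ℝ) (t : ℝ) {n₁ n₂ N : ℕ} (hN : n₂ ≤ N)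
    (ω : Fin N → ℝ × Vec k) :
    t * ∑ j : Fin N with n₁ ≤ j.val ∧ j.val < n₂, ((ω j).1 - p j) - springEnergy γ p ω =
      ((n₂ - n₁ : ℕ) : ℝ) * (t ^ 2 / (4 * γ))
        - springEnergy γ (fun j => p j + if n₁ ≤ j ∧ j < n₂ then t / (2 * γ) else 0) ω := by
  unfold springEnergy
  rw [← card_filter_fin (c₀ := n₁) hN, Finset.cast_card, Finset.sum_mul, Finset.mul_sum,
    Finset.mul_sum, Finset.mul_sum, Finset.sum_filter, Finset.sum_filter,
    ← Finset.sum_sub_distrib, ← Finset.sum_sub_distrib]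
  refine Finset.sum_congr rfl fun j _ => ?_
  dsimp only
  split_ifs
  · field_simp; ring
  · simp

/-- The shifted window is restored by moving everything beyond one end and moving back everything
beyond the other. The spill is kept at one end only, where the first surgery takes place. -/
theorem exists_tilt {D : CrossSection k} {V : Vec k → Vec k → ℝ → ℝ} {g : ℝ → ℝ}
    {κ G lam γ τ : ℝ} (hV : PairBounds D V g κ (lam / 4) G)
    (hVm : Measurable fun q : Vec k × Vec k × ℝ => V q.1 q.2.1 q.2.2)
    (hlam : 0 < lam) (hγ : 0 < γ) (hτ : 0 ≤ τ) (t : ℝ) :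
    ∃ C : ℝ, 0 ≤ C ∧ ∃ M : ℕ, ∀ {L u : ℝ} {n n₁ n₂ N : ℕ}, M ≤ N → n₁ ≤ n₂ → n₂ ≤ N →
      (n = n₁ ∨ n = n₂) → |u - (L + lam / 2 + n * lam)| ≤ lam →
      ∫⁻ ω : Fin N → ℝ × Vec k, ENNReal.ofReal (Real.exp (τ * spill n u ω +
          t * ∑ j : Fin N with n₁ ≤ j.val ∧ j.val < n₂, ((ω j).1 - (L + lam / 2 + j * lam)))) *
        weight D V γ (fun j => L + lam / 2 + j * lam) L (L + N * lam) ω ≤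
        ENNReal.ofReal (C * Real.exp (((n₂ - n₁ : ℕ) : ℝ) * (t ^ 2 / (4 * γ)))) *
          ∫⁻ ω : Fin N → ℝ × Vec k,
            weight D V γ (fun j => L + lam / 2 + j * lam) L (L + N * lam) ω := by
  set s : ℝ := t / (2 * γ) with hs
  obtain ⟨C, hC0, M, hC⟩ := exists_surgery (R := |s| + lam) hV hVm hlam hγ hτ (by positivity)
  refine ⟨C * C, by positivity, M, ?_⟩
  intro L u n n₁ n₂ N hMN h12 h2N hn hu
  have hsabs := abs_nonneg s
  have habs : ∀ a : ℝ, |a| ≤ lam → |a| ≤ |s| + lam := fun a ha => by linarith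
  have hself : |s| ≤ |s| + lam := by linarith
  have hnegself : |-s| ≤ |s| + lam := by rw [abs_neg]; linarith
  have h0 : |(0 : ℝ)| ≤ |s| + lam := by rw [abs_zero]; linarith
  have hw₀ : |L - (L + lam / 2)| ≤ |s| + lam := by
    rw [sub_add_cancel_left, abs_neg, abs_of_pos (half_pos hlam)]; linarith
  have hw : ∀ v : ℝ, |v| ≤ |s| → |L + N * lam + v - (L + lam / 2 + N * lam)| ≤ |s| + lam := by
    intro v hv
    rw [show L + N * lam + v - (L + lam / 2 + N * lam) = v - lam / 2 by ring]
    refine (abs_sub _ _).trans ?_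
    rw [abs_of_pos (half_pos hlam)]; linarith
  have hwz := hw 0 (by simp)
  rw [add_zero] at hwz
  -- The second surgery needs no spill; inserting its nonnegative spill term is free.
  have hdrop : ∀ (n : ℕ) (p : ℕ → ℝ) (L' : ℝ),
      ∫⁻ ω : Fin N → ℝ × Vec k, weight D V γ p L L' ω ≤
      ∫⁻ ω : Fin N → ℝ × Vec k, ENNReal.ofReal (Real.exp (τ *
        spill n (L + lam / 2 + n * lam) ω)) * weight D V γ p L L' ω := by
    intro n p L'
    refine lintegral_mono fun ω => le_mul_of_one_le_left zero_le ?_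
    rw [ENNReal.one_le_ofReal, Real.one_le_exp_iff]
    exact mul_nonneg hτ (spill_nonneg _ _ _)
  have htilt : ∀ ω : Fin N → ℝ × Vec k, ENNReal.ofReal (Real.exp (τ * spill n u ω +
          t * ∑ j : Fin N with n₁ ≤ j.val ∧ j.val < n₂, ((ω j).1 - (L + lam / 2 + j * lam)))) *
        weight D V γ (fun j => L + lam / 2 + j * lam) L (L + N * lam) ω =
        ENNReal.ofReal (Real.exp (((n₂ - n₁ : ℕ) : ℝ) * (t ^ 2 / (4 * γ)))) *
        (ENNReal.ofReal (Real.exp (τ * spill n u ω)) *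
        weight D V γ (fun j => L + lam / 2 + j * lam + if n₁ ≤ j ∧ j < n₂ then s else 0)
          L (L + N * lam) ω) := by
    intro ω
    by_cases hmem : ω ∈ configs D N L (L + N * lam)
    swap
    · simp [weight, hmem]
    simp only [weight, indicator_of_mem hmem]
    rw [← ENNReal.ofReal_mul (Real.exp_pos _).le, ← ENNReal.ofReal_mul (Real.exp_pos _).le,
      ← ENNReal.ofReal_mul (Real.exp_pos _).le, ← Real.exp_add, ← Real.exp_add, ← Real.exp_add]
    have := springEnergy_tilt hγ (fun j => L + lam / 2 + j * lam) t (n₁ := n₁) h2N ω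
    congr 2
    linarith
  simp only [htilt]
  rw [lintegral_const_mul' _ _ ENNReal.ofReal_ne_top, mul_comm (C * C),
    ENNReal.ofReal_mul (Real.exp_pos _).le, mul_assoc, ENNReal.ofReal_mul hC0, mul_assoc]
  refine mul_le_mul_right ?_ _
  -- The first surgery is made at the end carrying the spill: a shift by -s at n₁, or by s at n₂.
  -- The second, at the other end, has the opposite shift and returns the wall to its place.
  rcases hn with rfl | rfl
  · have h1 := hC (P := L + lam / 2) (s := -s) (ℓ := L) (ℓ' := L + N * lam) (u := u) (n := n)
      (N := N) (p := fun j => L + lam / 2 + j * lam + if n ≤ j ∧ j < n₂ then s else 0)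
      (p' := fun j => L + lam / 2 + j * lam + if n₂ ≤ j then -s else 0)
      hMN (by omega) hw₀ hwz (hw _ (abs_neg s).le)
      (fun j _ => by simp only [add_sub_cancel_left]; split_ifs <;> assumption)
      (fun j _ => by simp only [add_sub_cancel_left]; split_ifs <;> assumption)
      (fun j hj => by
        rw [if_neg (by omega), if_neg (by omega)])
      (fun j hj => by
        by_cases hj2 : j < n₂
        · rw [if_neg (by omega), if_pos ⟨hj, hj2⟩]; ring
        · rw [if_pos (by omega), if_neg (by omega)]; ring)
      (habs _ hu)
    have h2 := hC (P := L + lam / 2) (s := s) (ℓ := L) (ℓ' := L + N * lam + -s)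
      (u := L + lam / 2 + n₂ * lam) (n := n₂) (N := N)
      (p := fun j => L + lam / 2 + j * lam + if n₂ ≤ j then -s else 0)
      (p' := fun j => L + lam / 2 + j * lam)
      hMN (by omega) hw₀ (hw _ (abs_neg s).le) (by rw [neg_add_cancel_right]; exact hwz)
      (fun j _ => by simp only [add_sub_cancel_left]; split_ifs <;> assumption)
      (fun j _ => by simpa using h0)
      (fun j hj => by rw [if_neg (by omega), add_zero])
      (fun j hj => by rw [if_pos hj]; ring)
      (by rw [sub_self]; exact h0)
    rw [neg_add_cancel_right] at h2
    exact h1.trans (mul_le_mul_right ((hdrop _ _ _).trans h2) _)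
  · have h1 := hC (P := L + lam / 2) (s := s) (ℓ := L) (ℓ' := L + N * lam) (u := u) (n := n)
      (N := N) (p := fun j => L + lam / 2 + j * lam + if n₁ ≤ j ∧ j < n then s else 0)
      (p' := fun j => L + lam / 2 + j * lam + if n₁ ≤ j then s else 0)
      hMN (by omega) hw₀ hwz (hw _ le_rfl)
      (fun j _ => by simp only [add_sub_cancel_left]; split_ifs <;> assumption)
      (fun j _ => by simp only [add_sub_cancel_left]; split_ifs <;> assumption)
      (fun j hj => by simp only [hj, and_true])
      (fun j hj => by
        rw [if_pos (by omega), if_neg (by omega)]; ring)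
      (habs _ hu)
    have h2 := hC (P := L + lam / 2) (s := -s) (ℓ := L) (ℓ' := L + N * lam + s)
      (u := L + lam / 2 + n₁ * lam) (n := n₁) (N := N)
      (p := fun j => L + lam / 2 + j * lam + if n₁ ≤ j then s else 0)
      (p' := fun j => L + lam / 2 + j * lam)
      hMN (by omega) hw₀ (hw _ le_rfl) (by rw [add_neg_cancel_right]; exact hwz)
      (fun j _ => by simp only [add_sub_cancel_left]; split_ifs <;> assumption)
      (fun j _ => by simpa using h0)
      (fun j hj => by rw [if_neg (by omega), add_zero])
      (fun j hj => by rw [if_pos hj]; ring)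
      (by rw [sub_self]; exact h0)
    rw [add_neg_cancel_right] at h2
    exact h1.trans (mul_le_mul_right ((hdrop _ _ _).trans h2) _)

/-! ### The window integral of the particle excess -/

theorem integral_indicator_Ici (a b x : ℝ) :
    ∫ u in Ioc a b, (if x ≤ u then (1 : ℝ) else 0) = max (b - max a x) 0 := by
  have : (fun u : ℝ => if x ≤ u then (1 : ℝ) else 0) = (Ici x).indicator 1 := by
    ext u; simp [indicator, mem_Ici]
  rw [this, integral_indicator_one measurableSet_Ici, measureReal_restrict_apply measurableSet_Ici,
    measureReal_congr (show (Ici x ∩ Ioc a b : Set ℝ) =ᵐ[volume] (Ioi x ∩ Ioc a b : Set ℝ) from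
      Ioi_ae_eq_Ici.symm.inter (ae_eq_refl _)), inter_comm, Ioc_inter_Ioi]
  rw [measureReal_def, Real.volume_Ioc, ENNReal.toReal_ofReal']

/-- The integral of the particle excess over a window. -/
theorem integral_excess {D : CrossSection k} {ρ : ℝ} (hc : 0 < cell D ρ) (L x : ℝ) {r : ℝ}
    (hr : 0 < r) (N : ℕ) :
    (∀ ω : Fin N → ℝ × Vec k,
      ∫ u in (0 : ℝ)..r, excess D ρ L (L + N * cell D ρ) ω (x + u) = 0) ∨
    ∃ a b : ℝ, L ≤ a ∧ a ≤ b ∧ b ≤ L + N * cell D ρ ∧ b - a ≤ r ∧ ∀ ω : Fin N → ℝ × Vec k,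
      ∫ u in (0 : ℝ)..r, excess D ρ L (L + N * cell D ρ) ω (x + u) =
        ((b - L) ^ 2 - (a - L) ^ 2) / (2 * cell D ρ) - ∑ j, max (b - max a (ω j).1) 0 := by
  classical
  set lam := cell D ρ with hlam
  have hexc : ∀ ω : Fin N → ℝ × Vec k,
      ∫ u in (0 : ℝ)..r, excess D ρ L (L + N * lam) ω (x + u) =
        ∫ u in Ioc (max x L) (min (x + r) (L + N * lam)),
          ((u - L) / lam - ∑ j, if (ω j).1 ≤ u then (1 : ℝ) else 0) := by
    intro ω
    rw [intervalIntegral.integral_comp_add_left (fun u => excess D ρ L (L + N * lam) ω u) x,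
      add_zero, intervalIntegral.integral_of_le (by linarith)]
    have : (fun u => excess D ρ L (L + N * lam) ω u) = (Icc L (L + N * lam)).indicator fun u =>
        ((u - L) / lam - ∑ j, if (ω j).1 ≤ u then (1 : ℝ) else 0) := by
      ext u
      simp only [excess, indicator, Finset.sum_boole]
      congr
    rw [this, setIntegral_indicator measurableSet_Icc]
    have hset : (Ioc x (x + r) ∩ Icc L (L + N * lam) : Set ℝ) =ᵐ[volume]
        (Ioc (max x L) (min (x + r) (L + N * lam)) : Set ℝ) := by
      have := (ae_eq_refl (μ := volume) (Ioc x (x + r))).inter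
        (Ioc_ae_eq_Icc (μ := volume) (a := L) (b := L + N * lam)).symm
      rwa [Ioc_inter_Ioc] at this
    rw [setIntegral_congr_set hset]
  rcases lt_or_ge (min (x + r) (L + N * lam)) (max x L) with h | h
  · refine .inl fun ω => ?_
    rw [hexc, Ioc_eq_empty h.le.not_gt]
    simp
  · refine .inr ⟨max x L, min (x + r) (L + N * lam), le_max_right _ _, h, min_le_right _ _, ?_,
      fun ω => ?_⟩
    · have h1 := min_le_left (x + r) (L + N * lam)
      have h2 := le_max_left x L
      linarith
    · rw [hexc]
      set a := max x L
      set b := min (x + r) (L + N * lam)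
      have hint : ∀ j, IntegrableOn (fun u : ℝ => if (ω j).1 ≤ u then (1 : ℝ) else 0) (Ioc a b) := by
        intro j
        have : (fun u : ℝ => if (ω j).1 ≤ u then (1 : ℝ) else 0) = (Ici (ω j).1).indicator 1 := by
          ext u; simp [indicator, mem_Ici]
        rw [this]
        exact (integrable_const (1 : ℝ)).indicator measurableSet_Ici
      rw [integral_sub]
      · rw [integral_finsetSum _ fun j _ => hint j]
        simp only [integral_indicator_Ici]
        rw [← intervalIntegral.integral_of_le h, intervalIntegral.integral_div,
          intervalIntegral.integral_comp_sub_right (fun u => u) L, integral_id]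
        congr 1
        field_simp
      · exact (Continuous.integrableOn_Icc (by fun_prop)).mono_set Ioc_subset_Icc_self
      · exact integrable_finsetSum _ fun j _ => hint j

theorem sum_lattice_Ico {n₁ n₂ : ℕ} (h : n₁ ≤ n₂) (a c : ℝ) :
    ∑ j ∈ Finset.Ico n₁ n₂, (a - c / 2 - j * c)
      = (n₂ - n₁) * a - c * ((n₂ : ℝ) ^ 2 - (n₁ : ℝ) ^ 2) / 2 := by
  induction n₂, h using Nat.le_induction with
  | base => simp
  | succ m hm ih =>
    rw [Finset.sum_Ico_succ_top hm, ih]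
    push_cast
    ring

/-- A crude bound for systems with too few particles for the surgery. -/
theorem abs_integral_excess_le {lam L a b : ℝ} {N : ℕ} (hlam : 0 < lam) (ha : L ≤ a) (hab : a ≤ b)
    (hb : b ≤ L + N * lam) (ω : Fin N → ℝ × Vec k) :
    |((b - L) ^ 2 - (a - L) ^ 2) / (2 * lam) - ∑ j, max (b - max a (ω j).1) 0| ≤ N ^ 2 * lam := by
  have hN : (0 : ℝ) ≤ N := N.cast_nonneg
  have h1 : 0 ≤ ∑ j, max (b - max a (ω j).1) 0 := Finset.sum_nonneg fun j _ => le_max_right _ _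
  have h2 : ∑ j, max (b - max a (ω j).1) 0 ≤ ∑ _j : Fin N, (N : ℝ) * lam :=
    Finset.sum_le_sum fun j _ => max_le (by linarith [le_max_left a (ω j).1]) (by positivity)
  have h3 : 0 ≤ ((b - L) ^ 2 - (a - L) ^ 2) / (2 * lam) :=
    div_nonneg (by nlinarith) (by positivity)
  have h4 : ((b - L) ^ 2 - (a - L) ^ 2) / (2 * lam) ≤ N ^ 2 * lam := by
    rw [div_le_iff₀ (by positivity)]
    have : (b - L) ^ 2 ≤ (N * lam) ^ 2 := pow_le_pow_left₀ (by linarith) (by linarith) 2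
    nlinarith [sq_nonneg (a - L), sq_nonneg (N * lam)]
  simp only [Finset.sum_const, Finset.card_univ, Fintype.card_fin, nsmul_eq_mul] at h2
  rw [abs_le]
  constructor <;> nlinarith

/-- With n₁, n₂ the integer parts of the endpoints in units of cells, the contribution of each
particle is replaced by the one its label predicts. The errors are one-sided, so each sign needs the
spill at one end only. -/
theorem exists_excess_bounds {lam L a b : ℝ} {N : ℕ} (hlam : 0 < lam) (ha : L ≤ a) (hab : a ≤ b)
    (hb : b ≤ L + N * lam) :
    ∃ n₁ n₂ : ℕ, n₁ ≤ n₂ ∧ n₂ ≤ N ∧ ((n₂ - n₁ : ℕ) : ℝ) ≤ (b - a) / lam + 1 ∧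
      |a - (L + lam / 2 + n₁ * lam)| ≤ lam ∧ |b - (L + lam / 2 + n₂ * lam)| ≤ lam ∧
      ∀ ω : Fin N → ℝ × Vec k,
        ((b - L) ^ 2 - (a - L) ^ 2) / (2 * lam) - ∑ j, max (b - max a (ω j).1) 0 ≤
          lam / 2 + spill n₁ a ω +
          ∑ j : Fin N with n₁ ≤ j.val ∧ j.val < n₂, ((ω j).1 - (L + lam / 2 + j * lam)) ∧
        -(((b - L) ^ 2 - (a - L) ^ 2) / (2 * lam) - ∑ j, max (b - max a (ω j).1) 0) ≤
          lam / 2 + spill n₂ b ω -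
          ∑ j : Fin N with n₁ ≤ j.val ∧ j.val < n₂, ((ω j).1 - (L + lam / 2 + j * lam)) := by
  set a' := (a - L) / lam with ha'
  set b' := (b - L) / lam with hb'
  have haeq : a = L + a' * lam := by rw [ha']; field_simp; ring
  have hbeq : b = L + b' * lam := by rw [hb']; field_simp; ring
  have ha0 : 0 ≤ a' := div_nonneg (by linarith) hlam.le
  have hab' : a' ≤ b' := by rw [ha', hb']; gcongr
  have hbN : b' ≤ N := by rw [hb', div_le_iff₀ hlam]; linarith
  have f1 := Nat.floor_le ha0
  have f2 := Nat.lt_floor_add_one a'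
  have f3 := Nat.floor_le (ha0.trans hab')
  have f4 := Nat.lt_floor_add_one b'
  have hle : ⌊a'⌋₊ ≤ ⌊b'⌋₊ := Nat.floor_le_floor hab'
  have hleN : ⌊b'⌋₊ ≤ N := Nat.floor_le_of_le hbN
  have habs : ∀ v : ℝ, ∀ n : ℕ, (n : ℝ) ≤ v → v < n + 1 →
      |L + v * lam - (L + lam / 2 + n * lam)| ≤ lam := by
    intro v n h1 h2
    rw [abs_le]
    constructor <;> nlinarith
  refine ⟨⌊a'⌋₊, ⌊b'⌋₊, hle, hleN, ?_, ?_, ?_, fun ω => ?_⟩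
  · rw [Nat.cast_sub hle, show (b - a) / lam = b' - a' by rw [ha', hb']; ring]
    linarith
  · rw [haeq]; exact habs _ _ f1 f2
  · rw [hbeq]; exact habs _ _ f3 f4
  set n₁ := ⌊a'⌋₊
  set n₂ := ⌊b'⌋₊
  have hsum : ∑ j : Fin N, (if (j : ℕ) < n₁ then b - a else if (j : ℕ) < n₂ then b - (ω j).1 else 0)
      = n₁ * (b - a) + ((n₂ - n₁) * (b - L) - lam * ((n₂ : ℝ) ^ 2 - (n₁ : ℝ) ^ 2) / 2)
        - ∑ j : Fin N with n₁ ≤ j.val ∧ j.val < n₂, ((ω j).1 - (L + lam / 2 + j * lam)) := by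
    have e1 : (n₁ : ℝ) * (b - a) = ∑ j : Fin N with 0 ≤ j.val ∧ j.val < n₁, (b - a) := by
      rw [Finset.sum_const, card_filter_fin (hle.trans hleN), nsmul_eq_mul, Nat.sub_zero]
    rw [e1, ← sum_lattice_Ico hle, ← sum_filter_fin hleN, add_sub_assoc, ← Finset.sum_sub_distrib,
      Finset.sum_filter, Finset.sum_filter, ← Finset.sum_add_distrib]
    refine Finset.sum_congr rfl fun j _ => ?_
    by_cases h1 : (j : ℕ) < n₁
    · rw [if_pos h1, if_pos ⟨Nat.zero_le _, h1⟩, if_neg (by omega), add_zero]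
    · by_cases h2 : (j : ℕ) < n₂
      · rw [if_neg h1, if_pos h2, if_neg (by omega), if_pos ⟨by omega, h2⟩]; ring
      · rw [if_neg h1, if_neg h2, if_neg (by omega), if_neg (by omega), add_zero]
  -- The lattice sum reproduces the background integral up to the squared fractional parts of the
  -- endpoints, hence the error `lam / 2`.
  have hcurly : ((b - L) ^ 2 - (a - L) ^ 2) / (2 * lam) - (n₁ * (b - a)
      + ((n₂ - n₁) * (b - L) - lam * ((n₂ : ℝ) ^ 2 - (n₁ : ℝ) ^ 2) / 2))
      = lam / 2 * ((b' - n₂) ^ 2 - (a' - n₁) ^ 2) := by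
    rw [haeq, hbeq]; field_simp; ring
  have g1 : lam / 2 * ((b' - n₂) ^ 2 - (a' - n₁) ^ 2) ≤ lam / 2 := by
    have : (b' - n₂) ^ 2 ≤ 1 := by nlinarith
    nlinarith [sq_nonneg (a' - n₁)]
  have g2 : -(lam / 2) ≤ lam / 2 * ((b' - n₂) ^ 2 - (a' - n₁) ^ 2) := by
    have : (a' - n₁) ^ 2 ≤ 1 := by nlinarith
    nlinarith [sq_nonneg (b' - n₂)]
  constructor
  · have : ∑ j : Fin N, (if (j : ℕ) < n₁ then b - a else if (j : ℕ) < n₂ then b - (ω j).1 else 0)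
        ≤ ∑ j, max (b - max a (ω j).1) 0 + spill n₁ a ω := by
      unfold spill
      rw [← Finset.sum_add_distrib]
      refine Finset.sum_le_sum fun j _ => ?_
      have m0 := le_max_left (b - max a (ω j).1) 0
      have m1 := le_max_right (b - max a (ω j).1) 0
      rcases max_cases a (ω j).1 with h | h <;> split_ifs <;>
        linarith [le_max_left ((ω j).1 - a) 0, le_max_right ((ω j).1 - a) 0,
          le_max_left (a - (ω j).1) 0, le_max_right (a - (ω j).1) 0]
    linarith
  · have : ∑ j, max (b - max a (ω j).1) 0 ≤ spill n₂ b ω +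
        ∑ j : Fin N, (if (j : ℕ) < n₁ then b - a else if (j : ℕ) < n₂ then b - (ω j).1 else 0) := by
      unfold spill
      rw [← Finset.sum_add_distrib]
      refine Finset.sum_le_sum fun j _ => ?_
      have m0 := le_max_left ((ω j).1 - b) 0
      have m1 := le_max_right ((ω j).1 - b) 0
      have m2 := le_max_left (b - (ω j).1) 0
      have m3 := le_max_right (b - (ω j).1) 0
      have m4 := le_max_left a (ω j).1
      have m5 := le_max_right a (ω j).1
      split_ifs <;> first | omega | exact max_le (by linarith) (by linarith)
    linarith

end Jellium

/-! ### The jellium energy as springs with a short-range interaction -/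

namespace Jellium

open scoped ENNReal

variable {k : ℕ} {ι : Type}

theorem W_pos (D : CrossSection k) : 0 < D.W :=
  ENNReal.toReal_pos (volume_carrier_ne_zero D) (volume_carrier_ne_top D)

theorem cell_pos (D : CrossSection k) {ρ : ℝ} (hρ : 0 < ρ) : 0 < cell D ρ :=
  inv_pos.2 (mul_pos hρ (W_pos D))

theorem V₂_symm (ev : ι → ℝ) (φ : ι → Vec k → ℝ) (y y' : Vec k) (t : ℝ) :
    V₂ ev φ y y' t = V₂ ev φ y' y t :=
  tsum_congr fun _ => mul_right_comm _ _ _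

open Classical in
/-- The short-range potential inside the cross-section, extended by zero. -/
noncomputable def V₂inside (D : CrossSection k) (ev : ι → ℝ) (φ : ι → Vec k → ℝ)
    (y y' : Vec k) (t : ℝ) : ℝ :=
  if y ∈ D.carrier ∧ y' ∈ D.carrier ∧ 0 < t then V₂ ev φ y y' t else 0

variable {D : CrossSection k} {ev : ι → ℝ} {φ : ι → Vec k → ℝ} {g : ℝ → ℝ}

theorem V₂inside_eq {y y' : Vec k} {t : ℝ} (hy : y ∈ D.carrier) (hy' : y' ∈ D.carrier)
    (ht : 0 < t) : V₂inside D ev φ y y' t = V₂ ev φ y y' t := if_pos ⟨hy, hy', ht⟩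

/-- A pointwise limit of finite partial sums along the countable directed set of finite subsets of
ι; the restriction to the carrier and to t > 0 is where convergence is assumed. -/
theorem measurable_V₂inside [Countable ι] (hD : D.IsAdmissible ev φ g) :
    Measurable fun q : Vec k × Vec k × ℝ => V₂inside D ev φ q.1 q.2.1 q.2.2 := by
  classical
  have hc := measurableSet_carrier D
  have hset : MeasurableSet {q : Vec k × Vec k × ℝ |
      q.1 ∈ D.carrier ∧ q.2.1 ∈ D.carrier ∧ 0 < q.2.2} :=
    (hc.preimage measurable_fst).inter ((hc.preimage (measurable_fst.comp measurable_snd)).inter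
      (measurableSet_Ioi.preimage (measurable_snd.comp measurable_snd)))
  have hφ := hD.eigenbasis.measurable
  refine measurable_of_tendsto_metrizable' (u := Filter.atTop)
    (f := fun (F : Finset ι) (q : Vec k × Vec k × ℝ) =>
      if q.1 ∈ D.carrier ∧ q.2.1 ∈ D.carrier ∧ 0 < q.2.2 then
        ∑ n ∈ F, modeTerm ev φ q.1 q.2.1 q.2.2 n else 0) (fun F => ?_) ?_
  · refine Measurable.ite hset ?_ measurable_const
    refine Finset.measurable_fun_sum _ fun n _ => ?_
    unfold modeTerm
    have h1 : Measurable fun q : Vec k × Vec k × ℝ => φ n q.1 := (hφ n).comp measurable_fst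
    have h2 : Measurable fun q : Vec k × Vec k × ℝ => φ n q.2.1 :=
      (hφ n).comp (measurable_fst.comp measurable_snd)
    exact ((by fun_prop : Measurable fun q : Vec k × Vec k × ℝ =>
      (2 * √(ev n))⁻¹ * Real.exp (-q.2.2 * √(ev n))).mul h1).mul h2
  · rw [tendsto_pi_nhds]
    intro q
    unfold V₂inside
    by_cases hq : q.1 ∈ D.carrier ∧ q.2.1 ∈ D.carrier ∧ 0 < q.2.2
    · simp only [if_pos hq]
      exact (hD.summable _ hq.2.2 _ hq.1 _ hq.2.1).hasSum
    · simp only [if_neg hq]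
      exact tendsto_const_nhds

theorem exists_pairBounds (hD : D.IsAdmissible ev φ g) {b lam : ℝ} (hb : 0 < b) (hlam : 0 < lam) :
    ∃ κ G : ℝ, PairBounds D (fun y y' t => b * V₂inside D ev φ y y' t) (fun t => b * g t) κ
      (lam / 4) G := by
  have hpos : ∀ t, 0 ≤ t → 0 < b * g t := fun t ht => mul_pos hb (hD.g_pos t ht)
  have hanti : AntitoneOn (fun t => b * g t) (Ici 0) := fun s hs t ht h =>
    mul_le_mul_of_nonneg_left (hD.g_anti hs ht h) hb.le
  have hint : IntegrableOn (fun t => t * (b * g t)) (Ioi 0) := by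
    have : (fun t => t * (b * g t)) = fun t => b * (t * g t) := by ext; ring
    rw [this]
    exact hD.g_finite.const_mul b
  have hε : 0 < lam / 4 := by positivity
  obtain ⟨G₁, h1, hG₁⟩ := exists_sum_cut_le hpos hanti hint hε
  obtain ⟨G₂, h2, hG₂⟩ := exists_sum_pairs_cut_le hpos hanti hint hε
  obtain ⟨c, hc, hup⟩ := hD.upper (lam / 4) hε
  refine ⟨c, G₁ + G₂, hpos, hanti, fun t ht y hy y' hy' => ?_, fun t ht y hy y' hy' => ?_, hc.le,
    hε, by positivity, fun F f hf T hT => (hG₁ F f hf T hT).trans (by gcongr; linarith),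
    fun c => (hG₂ c).trans (by linarith)⟩
  · rw [V₂inside_eq hy hy' ht, ← mul_neg]
    exact mul_le_mul_of_nonneg_left (hD.lower t ht y hy y' hy') hb.le
  · rw [V₂inside_eq hy hy' (hε.trans_le ht), mul_left_comm]
    exact mul_le_mul_of_nonneg_left (hup t ht y hy y' hy') hb.le

theorem integrableOn_slice [Countable ι] (hD : D.IsAdmissible ev φ g) {y : Vec k}
    (hy : y ∈ D.carrier) {t : ℝ} (ht : 0 < t) :
    IntegrableOn (fun y' => V₂inside D ev φ y y' t) D.carrier := by
  obtain ⟨c, hc, hup⟩ := hD.upper t ht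
  have hm : Measurable fun y' => V₂inside D ev φ y y' t :=
    (measurable_V₂inside hD).comp (g := fun q : Vec k × Vec k × ℝ => V₂inside D ev φ q.1 q.2.1 q.2.2)
      (f := fun y' : Vec k => (y, y', t)) (by fun_prop)
  refine Measure.integrableOn_of_bounded (volume_carrier_ne_top D) hm.aestronglyMeasurable
    (M := (c + 1) * g t) ?_
  filter_upwards [ae_restrict_mem (measurableSet_carrier D)] with y' hy'
  have h1 := hD.lower t ht y hy y' hy'
  have h2 := hup t le_rfl y hy y' hy'
  have h3 := hD.g_pos t ht.le
  rw [V₂inside_eq hy hy' ht, Real.norm_eq_abs, abs_le]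
  constructor <;> nlinarith

theorem integral_slice (hD : D.IsAdmissible ev φ g) {y : Vec k}
    (hy : y ∈ D.carrier) {t : ℝ} (ht : 0 < t) :
    ∫ y' in D.carrier, V₂inside D ev φ y y' t = 0 := by
  rw [← hD.average t ht y hy]
  refine setIntegral_congr_fun (measurableSet_carrier D) fun y' hy' => ?_
  rw [V₂inside_eq hy hy' ht, V₂_symm]

theorem ae_pos_dist (x L₁ L₂ : ℝ) : ∀ᵐ x' ∂(volume.restrict (Icc L₁ L₂)), 0 < |x - x'| := by
  refine ae_restrict_of_ae ?_
  filter_upwards [(measure_eq_zero_iff_ae_notMem.1 (Real.volume_singleton (a := x)))] with x' hx'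
  rw [abs_pos, sub_ne_zero]
  exact fun h => hx' h.symm

/-- No upper bound on V₂ is available near t = 0. Instead |V₂| ≤ V₂ + 2g(0), and the vanishing
average bounds the L¹ norm of every slice. -/
theorem integrable_tube [Countable ι] (hD : D.IsAdmissible ev φ g) {y : Vec k}
    (hy : y ∈ D.carrier) (x L₁ L₂ : ℝ) :
    Integrable (fun z : ℝ × Vec k => V₂inside D ev φ y z.2 |x - z.1|)
      ((volume.restrict (Icc L₁ L₂)).prod (volume.restrict D.carrier)) := by
  have hm : Measurable fun z : ℝ × Vec k => V₂inside D ev φ y z.2 |x - z.1| :=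
    (measurable_V₂inside hD).comp (g := fun q : Vec k × Vec k × ℝ => V₂inside D ev φ q.1 q.2.1 q.2.2)
      (f := fun z : ℝ × Vec k => (y, z.2, |x - z.1|))
      (Measurable.prodMk measurable_const (Measurable.prodMk measurable_snd
        (measurable_const.sub measurable_fst).abs))
  have hms := hm.aestronglyMeasurable (μ := (volume.restrict (Icc L₁ L₂)).prod
    (volume.restrict D.carrier))
  rw [integrable_prod_iff hms]
  refine ⟨?_, ?_⟩
  · filter_upwards [ae_pos_dist x L₁ L₂] with x' hx'
    exact integrableOn_slice hD hy hx'
  · have : IsFiniteMeasure (volume.restrict (Icc L₁ L₂)) :=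
      ⟨by simp [Real.volume_Icc]⟩
    refine Integrable.of_bound hms.norm.integral_prod_right' (2 * g 0 * D.W) ?_
    filter_upwards [ae_pos_dist x L₁ L₂] with x' hx'
    rw [Real.norm_of_nonneg (integral_nonneg fun _ => norm_nonneg _)]
    have hI := integrableOn_slice hD hy hx'
    calc ∫ y' in D.carrier, ‖V₂inside D ev φ y y' |x - x'|‖
        ≤ ∫ y' in D.carrier, (V₂inside D ev φ y y' |x - x'| + 2 * g 0) := by
          refine setIntegral_mono_on hI.norm (hI.add ?_) (measurableSet_carrier D)
            fun y' hy' => ?_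
          · exact integrableOn_const (volume_carrier_ne_top D)
          · have h1 := hD.lower _ hx' y hy y' hy'
            have h2 := hD.g_anti (by simp) hx'.le hx'.le
            have h3 := hD.g_pos 0 le_rfl
            rw [V₂inside_eq hy hy' hx', Real.norm_eq_abs, abs_le]
            constructor <;> linarith
      _ = 2 * g 0 * D.W := by
          rw [integral_add hI (integrableOn_const (volume_carrier_ne_top D)),
            integral_slice hD hy hx', zero_add, setIntegral_const, smul_eq_mul, mul_comm]
          rfl

theorem integral_Icc_abs_sub {x L₁ L₂ : ℝ} (h₁ : L₁ ≤ x) (h₂ : x ≤ L₂) :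
    ∫ x' in Icc L₁ L₂, |x - x'| = ((x - L₁) ^ 2 + (L₂ - x) ^ 2) / 2 := by
  rw [integral_Icc_eq_integral_Ioc, ← intervalIntegral.integral_of_le (h₁.trans h₂),
    ← intervalIntegral.integral_add_adjacent_intervals (b := x)
      (Continuous.intervalIntegrable (by fun_prop) _ _)
      (Continuous.intervalIntegrable (by fun_prop) _ _)]
  have e1 : ∫ x' in L₁..x, |x - x'| = ∫ x' in L₁..x, (x - x') := by
    refine intervalIntegral.integral_congr fun x' hx' => ?_
    rw [uIcc_of_le h₁] at hx'
    exact abs_of_nonneg (by linarith [hx'.2])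
  have e2 : ∫ x' in x..L₂, |x - x'| = ∫ x' in x..L₂, (x' - x) := by
    refine intervalIntegral.integral_congr fun x' hx' => ?_
    rw [uIcc_of_le h₂] at hx'
    rw [abs_sub_comm]
    exact abs_of_nonneg (by linarith [hx'.1])
  rw [e1, e2, intervalIntegral.integral_comp_sub_left (fun u => u) x,
    intervalIntegral.integral_comp_sub_right (fun u => u) x, integral_id, integral_id]
  ring

/-- The interaction of a particle with the background. -/
theorem integral_background [Countable ι] (hD : D.IsAdmissible ev φ g) {z : ℝ × Vec k}
    {L₁ L₂ : ℝ} (h₁ : L₁ ≤ z.1) (h₂ : z.1 ≤ L₂) (hz : z.2 ∈ D.carrier) :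
    ∫ z' in Icc L₁ L₂ ×ˢ D.carrier, potential D ev φ z z'
      = -((z.1 - L₁) ^ 2 + (L₂ - z.1) ^ 2) / 4 := by
  have hW := W_pos D
  rw [Measure.volume_eq_prod, ← Measure.prod_restrict]
  set μ := (volume.restrict (Icc L₁ L₂)).prod (volume.restrict D.carrier)
  have hae : potential D ev φ z =ᵐ[μ] fun z' =>
      -|z.1 - z'.1| / (2 * D.W) + V₂inside D ev φ z.2 z'.2 |z.1 - z'.1| := by
    have h3 : ∀ᵐ z' ∂μ, 0 < |z.1 - z'.1| :=
      Measure.quasiMeasurePreserving_fst.ae (ae_pos_dist z.1 L₁ L₂)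
    have h4 : ∀ᵐ z' ∂μ, z'.2 ∈ D.carrier :=
      Measure.quasiMeasurePreserving_snd.ae (ae_restrict_mem (measurableSet_carrier D))
    filter_upwards [h3, h4] with z' h3 h4
    rw [potential, V₂inside_eq hz h4 h3]
  have hI := integrable_tube hD hz z.1 L₁ L₂
  have hlin : Integrable (fun x' => -|z.1 - x'| / (2 * D.W)) (volume.restrict (Icc L₁ L₂)) :=
    Continuous.integrableOn_Icc (by fun_prop)
  have : IsFiniteMeasure (volume.restrict D.carrier) :=
    ⟨by simpa using D.isCompact_carrier.measure_lt_top⟩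
  rw [integral_congr_ae hae, integral_add (hlin.comp_fst _) hI, integral_prod _ hI,
    integral_fun_fst (f := fun x' => -|z.1 - x'| / (2 * D.W))]
  have hzero : ∫ x' in Icc L₁ L₂, ∫ y' in D.carrier, V₂inside D ev φ z.2 (x', y').2
      |z.1 - (x', y').1| = 0 := by
    refine integral_eq_zero_of_ae ?_
    filter_upwards [ae_pos_dist z.1 L₁ L₂] with x' hx'
    exact integral_slice hD hz hx'
  rw [hzero, integral_div, integral_neg, integral_Icc_abs_sub h₁ h₂, add_zero,
    measureReal_restrict_apply_univ, smul_eq_mul]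
  change D.W * _ = _
  field_simp
  ring

/-- The j-th point has j points to its left and N - 1 - j to its right, so the pair sum is linear on
ordered configurations. -/
theorem sum_pairs_abs_sub {N : ℕ} {x : Fin N → ℝ} (hx : StrictMono x) :
    ∑ i, ∑ j ∈ Finset.Ioi i, |x i - x j| = ∑ j : Fin N, (2 * (j : ℝ) + 1 - N) * x j := by
  have h1 : ∀ i, ∑ j ∈ Finset.Ioi i, |x i - x j|
      = ∑ j ∈ Finset.Ioi i, x j - ((N : ℝ) - 1 - i) * x i := by
    intro i
    have : ((Finset.Ioi i).card : ℝ) = (N : ℝ) - 1 - i := by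
      rw [Fin.card_Ioi, Nat.sub_sub, Nat.cast_sub (by omega)]
      push_cast; ring
    rw [← this, ← nsmul_eq_mul, ← Finset.sum_const, ← Finset.sum_sub_distrib]
    refine Finset.sum_congr rfl fun j hj => ?_
    rw [abs_sub_comm, abs_of_pos (sub_pos.2 (hx (Finset.mem_Ioi.1 hj)))]
  simp only [h1]
  rw [Finset.sum_sub_distrib, Finset.sum_comm' (t' := Finset.univ) (s' := fun j => Finset.Iio j)
    (by simp), ← Finset.sum_sub_distrib]
  refine Finset.sum_congr rfl fun j _ => ?_
  rw [Finset.sum_const, Fin.card_Iio, nsmul_eq_mul]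
  ring

/-- The energy of the jellium is that of particles bound by springs to equidistant sites, with the
short-range interaction. -/
theorem energy_eq [Countable ι] (hD : D.IsAdmissible ev φ g) {ρ : ℝ} (hρ : 0 < ρ) (q β L : ℝ)
    {N : ℕ} {ω : Fin N → ℝ × Vec k} (hω : ω ∈ configs D N L (L + N * cell D ρ)) :
    -β * energy D ev φ ρ q L (L + N * cell D ρ) ω =
      -β * ∑ j : Fin N, q ^ 2 * ρ / 2 *
        ((N * cell D ρ) ^ 2 / 2 - (cell D ρ / 2 + j * cell D ρ) ^ 2) +
      (-springEnergy (β * q ^ 2 * ρ / 2) (fun j => L + cell D ρ / 2 + j * cell D ρ) ω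
        - pairEnergy (fun y y' t => β * q ^ 2 * V₂inside D ev φ y y' t) ω) := by
  have hW := W_pos D
  have hWc : (2 * D.W)⁻¹ = ρ * cell D ρ / 2 := by rw [cell]; field_simp
  have hpair : pairEnergy (fun y y' t => β * q ^ 2 * V₂inside D ev φ y y' t) ω
      = β * ∑ i, ∑ j ∈ Finset.Ioi i, q ^ 2 * V₂ ev φ (ω i).2 (ω j).2 |(ω i).1 - (ω j).1| := by
    unfold pairEnergy
    rw [Finset.mul_sum]
    refine Finset.sum_congr rfl fun i _ => ?_
    rw [Finset.mul_sum]
    refine Finset.sum_congr rfl fun j hj => ?_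
    have hlt : (ω i).1 < (ω j).1 := hω.2 (Finset.mem_Ioi.1 hj)
    dsimp only
    rw [V₂inside_eq (hω.1 i).2 (hω.1 j).2 (abs_pos.2 (sub_ne_zero.2 hlt.ne)), mul_assoc]
  have hback : ∀ j, ∫ z in Icc L (L + N * cell D ρ) ×ˢ D.carrier, potential D ev φ (ω j) z
      = -(((ω j).1 - L) ^ 2 + (L + N * cell D ρ - (ω j).1) ^ 2) / 4 := fun j =>
    integral_background hD (hω.1 j).1.1.le (hω.1 j).1.2.le (hω.1 j).2
  have hlin : ∑ i, ∑ j ∈ Finset.Ioi i, q ^ 2 * potential D ev φ (ω i) (ω j)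
      = -(q ^ 2 * (ρ * cell D ρ / 2)) * ∑ j : Fin N, (2 * (j : ℝ) + 1 - N) * (ω j).1
        + ∑ i, ∑ j ∈ Finset.Ioi i, q ^ 2 * V₂ ev φ (ω i).2 (ω j).2 |(ω i).1 - (ω j).1| := by
    rw [← sum_pairs_abs_sub hω.2, Finset.mul_sum, ← Finset.sum_add_distrib]
    refine Finset.sum_congr rfl fun i _ => ?_
    rw [Finset.mul_sum, ← Finset.sum_add_distrib]
    refine Finset.sum_congr rfl fun j _ => ?_
    rw [potential, div_eq_mul_inv, hWc]
    ring
  unfold energy springEnergy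
  rw [hpair, hlin]
  simp only [hback]
  set X := ∑ i, ∑ j ∈ Finset.Ioi i, q ^ 2 * V₂ ev φ (ω i).2 (ω j).2 |(ω i).1 - (ω j).1|
  have key : -(q ^ 2 * (ρ * cell D ρ / 2)) * ∑ j : Fin N, (2 * (j : ℝ) + 1 - N) * (ω j).1
      - ∑ j, q ^ 2 * ρ * (-(((ω j).1 - L) ^ 2 + (L + N * cell D ρ - (ω j).1) ^ 2) / 4)
      = ∑ j : Fin N, q ^ 2 * ρ / 2 *
        ((N * cell D ρ) ^ 2 / 2 - (cell D ρ / 2 + j * cell D ρ) ^ 2)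
        + q ^ 2 * ρ / 2 * ∑ j : Fin N, ((ω j).1 - (L + cell D ρ / 2 + j * cell D ρ)) ^ 2
        + q ^ 2 * ρ / 2 * cell D ρ * L * ∑ j : Fin N, ((N : ℝ) - (2 * j + 1)) := by
    simp only [Finset.mul_sum]
    rw [← Finset.sum_sub_distrib, ← Finset.sum_add_distrib, ← Finset.sum_add_distrib]
    refine Finset.sum_congr rfl fun j _ => ?_
    ring
  -- Neutrality: this removes the term that depends on the position L of the system.
  have hzero : ∑ j : Fin N, ((N : ℝ) - (2 * j + 1)) = 0 := by
    rw [Fin.sum_univ_eq_sum_range (fun j => (N : ℝ) - (2 * j + 1))]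
    have : ∀ n : ℕ, ∑ j ∈ Finset.range n, ((N : ℝ) - (2 * j + 1)) = n * N - n ^ 2 := by
      intro n
      induction n with
      | zero => simp
      | succ n ih => rw [Finset.sum_range_succ, ih]; push_cast; ring
    rw [this]; ring
  rw [hzero, mul_zero, add_zero] at key
  calc _ = -β * ((-(q ^ 2 * (ρ * cell D ρ / 2)) * ∑ j : Fin N, (2 * (j : ℝ) + 1 - N) * (ω j).1
      - ∑ j, q ^ 2 * ρ * (-(((ω j).1 - L) ^ 2 + (L + N * cell D ρ - (ω j).1) ^ 2) / 4)) + X) := by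
        ring
    _ = _ := by rw [key]; ring

end Jellium

/-! ### Large deviations and normalization -/

namespace Jellium

open scoped ENNReal

variable {k : ℕ} {ι : Type} {D : CrossSection k} {ev : ι → ℝ} {φ : ι → Vec k → ℝ} {g : ℝ → ℝ}

/-- The unnormalized Gibbs measure of particles bound by springs to equidistant sites. -/
noncomputable def springMeasure (D : CrossSection k) (V : Vec k → Vec k → ℝ → ℝ) (γ lam L : ℝ)
    (N : ℕ) : Measure (Fin N → ℝ × Vec k) :=
  volume.withDensity (weight D V γ (fun j => L + lam / 2 + j * lam) L (L + N * lam))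

theorem boltzmann_eq [Countable ι] (hD : D.IsAdmissible ev φ g) {ρ : ℝ} (hρ : 0 < ρ) (q β L : ℝ)
    (N : ℕ) :
    ∃ c : ℝ, 0 < c ∧ boltzmann D ev φ ρ q β N L (L + N * cell D ρ) = ENNReal.ofReal c •
      springMeasure D (fun y y' t => β * q ^ 2 * V₂inside D ev φ y y' t) (β * q ^ 2 * ρ / 2)
        (cell D ρ) L N := by
  refine ⟨_, Real.exp_pos (-β * ∑ j : Fin N, q ^ 2 * ρ / 2 *
        ((N * cell D ρ) ^ 2 / 2 - (cell D ρ / 2 + j * cell D ρ) ^ 2)), ?_⟩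
  unfold boltzmann springMeasure
  rw [← withDensity_indicator (measurableSet_configs D N _ _), ← withDensity_smul'
    _ _ ENNReal.ofReal_ne_top]
  congr 1
  ext ω
  by_cases hω : ω ∈ configs D N L (L + N * cell D ρ)
  · simp only [weight, Pi.smul_apply, indicator_of_mem hω, smul_eq_mul]
    rw [energy_eq hD hρ q β L hω, Real.exp_add, ENNReal.ofReal_mul (Real.exp_pos _).le]
  · simp [weight, hω]

/-- Configurations with one particle in each cell have positive volume and positive weight. -/
theorem springMeasure_univ_ne_zero {V : Vec k → Vec k → ℝ → ℝ} {γ lam : ℝ} (hlam : 0 < lam)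
    (L : ℝ) (N : ℕ) (hVm : Measurable fun q : Vec k × Vec k × ℝ => V q.1 q.2.1 q.2.2) :
    springMeasure D V γ lam L N univ ≠ 0 := by
  rw [springMeasure, withDensity_apply _ MeasurableSet.univ, setLIntegral_univ]
  refine ((lintegral_pos_iff_support (measurable_weight D hVm _ _ _ _)).2 ?_).ne'
  have hsub : Set.pi univ (fun j : Fin N => Ioo (L + j * lam) (L + ((j : ℝ) + 1) * lam) ×ˢ D.carrier)
      ⊆ Function.support (weight D V γ (fun j => L + lam / 2 + j * lam) L (L + N * lam)) := by
    intro ω hω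
    have hω' := fun j => hω j (mem_univ j)
    have hmem : ω ∈ configs D N L (L + N * lam) := by
      refine ⟨fun j => ⟨⟨?_, ?_⟩, (hω' j).2⟩, fun i j hij => ?_⟩
      · exact lt_of_le_of_lt (by have : 0 ≤ (j : ℝ) * lam := by positivity
                                 linarith) (hω' j).1.1
      · refine (hω' j).1.2.trans_le ?_
        have : (j : ℝ) + 1 ≤ N := by exact_mod_cast j.2
        gcongr
      · refine (hω' i).1.2.trans (lt_of_le_of_lt ?_ (hω' j).1.1)
        have : (i : ℝ) + 1 ≤ j := by exact_mod_cast hij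
        gcongr
    rw [Function.mem_support, weight, indicator_of_mem hmem]
    exact (ENNReal.ofReal_pos.2 (Real.exp_pos _)).ne'
  refine lt_of_lt_of_le ?_ (measure_mono hsub)
  rw [volume_pi_pi]
  refine pos_iff_ne_zero.2 (Finset.prod_ne_zero_iff.2 fun j _ => ?_)
  rw [Measure.volume_eq_prod, Measure.prod_prod, Real.volume_Ioo]
  refine mul_ne_zero ?_ (volume_carrier_ne_zero D)
  rw [Ne, ENNReal.ofReal_eq_zero]
  linarith

theorem springMeasure_univ_ne_top {V : Vec k → Vec k → ℝ → ℝ} {γ lam κ G : ℝ}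
    (hγ : 0 ≤ γ) (hV : PairBounds D V g κ (lam / 4) G) (L : ℝ) (N : ℕ) :
    springMeasure D V γ lam L N univ ≠ ∞ := by
  rw [springMeasure, withDensity_apply _ MeasurableSet.univ, setLIntegral_univ]
  have hle : ∀ ω : Fin N → ℝ × Vec k,
      weight D V γ (fun j => L + lam / 2 + j * lam) L (L + N * lam) ω ≤
      (Set.pi univ (fun _ : Fin N => Ioo L (L + N * lam) ×ˢ D.carrier)).indicator (fun _ =>
        ENNReal.ofReal (Real.exp (∑ i : Fin N, ∑ _j ∈ Finset.Ioi i, g 0))) ω := by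
    intro ω
    by_cases hω : ω ∈ configs D N L (L + N * lam)
    · have hmem : ω ∈ Set.pi univ (fun _ : Fin N => Ioo L (L + N * lam) ×ˢ D.carrier) :=
        fun j _ => hω.1 j
      rw [weight, indicator_of_mem hω, indicator_of_mem hmem]
      refine ENNReal.ofReal_le_ofReal (Real.exp_le_exp.2 ?_)
      have h1 : 0 ≤ springEnergy γ (fun j => L + lam / 2 + j * lam) ω :=
        mul_nonneg hγ (Finset.sum_nonneg fun j _ => sq_nonneg _)
      have h2 : - pairEnergy V ω ≤ ∑ i : Fin N, ∑ _j ∈ Finset.Ioi i, g 0 := by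
        unfold pairEnergy
        rw [← Finset.sum_neg_distrib]
        refine Finset.sum_le_sum fun i _ => ?_
        rw [← Finset.sum_neg_distrib]
        refine Finset.sum_le_sum fun j hj => ?_
        have hlt : (ω i).1 < (ω j).1 := hω.2 (Finset.mem_Ioi.1 hj)
        have hpos : 0 < |(ω i).1 - (ω j).1| := abs_pos.2 (sub_ne_zero.2 hlt.ne)
        have h3 := hV.lower _ hpos _ (hω.1 i).2 _ (hω.1 j).2
        have h4 := hV.g_anti (by simp) hpos.le hpos.le
        linarith
      linarith
    · simp [weight, hω]
  refine ((lintegral_mono hle).trans_lt ?_).ne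
  rw [lintegral_indicator_const (MeasurableSet.univ_pi fun _ => measurableSet_Ioo.prod
    (measurableSet_carrier D)), volume_pi_pi]
  refine ENNReal.mul_lt_top ENNReal.ofReal_lt_top (ENNReal.prod_lt_top fun j _ => ?_)
  rw [Measure.volume_eq_prod, Measure.prod_prod, Real.volume_Ioo]
  exact ENNReal.mul_lt_top ENNReal.ofReal_lt_top (volume_carrier_ne_top D).lt_top

/-- The exponential Markov inequality. The two parameters t and t' allow the tilt to have either
sign while the spill always has coefficient t ≥ 0. -/
theorem springMeasure_tail {V : Vec k → Vec k → ℝ → ℝ}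
    (hVm : Measurable fun q : Vec k × Vec k × ℝ => V q.1 q.2.1 q.2.2) {γ lam L u t t' a C : ℝ}
    {n n₁ n₂ N : ℕ} (ht : 0 ≤ t) {I : (Fin N → ℝ × Vec k) → ℝ}
    (hI : ∀ ω, t * I ω ≤ t * (lam / 2) + t * spill n u ω +
      t' * ∑ j : Fin N with n₁ ≤ j.val ∧ j.val < n₂, ((ω j).1 - (L + lam / 2 + j * lam)))
    (h : ∫⁻ ω : Fin N → ℝ × Vec k, ENNReal.ofReal (Real.exp (t * spill n u ω +
          t' * ∑ j : Fin N with n₁ ≤ j.val ∧ j.val < n₂, ((ω j).1 - (L + lam / 2 + j * lam)))) *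
        weight D V γ (fun j => L + lam / 2 + j * lam) L (L + N * lam) ω ≤
        ENNReal.ofReal C * ∫⁻ ω : Fin N → ℝ × Vec k,
            weight D V γ (fun j => L + lam / 2 + j * lam) L (L + N * lam) ω) :
    springMeasure D V γ lam L N {ω | a ≤ I ω} ≤
      ENNReal.ofReal (Real.exp (t * (lam / 2) - t * a) * C) *
        springMeasure D V γ lam L N univ := by
  unfold springMeasure
  rw [withDensity_apply _ MeasurableSet.univ, setLIntegral_univ, withDensity_apply',
    ENNReal.ofReal_mul (Real.exp_pos _).le, mul_assoc]
  refine le_trans ?_ (mul_le_mul_right h _)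
  have hm : Measurable fun ω : Fin N → ℝ × Vec k => ENNReal.ofReal (Real.exp (t * spill n u ω +
          t' * ∑ j : Fin N with n₁ ≤ j.val ∧ j.val < n₂, ((ω j).1 - (L + lam / 2 + j * lam)))) *
        weight D V γ (fun j => L + lam / 2 + j * lam) L (L + N * lam) ω := by
    refine Measurable.mul ?_ (measurable_weight D hVm _ _ _ _)
    refine (Real.measurable_exp.comp (((measurable_spill n u).const_mul t).add ?_)).ennreal_ofReal
    fun_prop
  rw [← lintegral_const_mul _ hm]
  refine le_trans (setLIntegral_mono (hm.const_mul _) fun ω hω => ?_)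
    (setLIntegral_le_lintegral {ω | a ≤ I ω} _)
  rw [← mul_assoc]
  refine le_mul_of_one_le_left zero_le ?_
  rw [← ENNReal.ofReal_mul (Real.exp_pos _).le, ← Real.exp_add, ENNReal.one_le_ofReal,
    Real.one_le_exp_iff]
  have h1 := hI ω
  have h2 : t * a ≤ t * I ω := mul_le_mul_of_nonneg_left hω ht
  linarith

/-- Large deviations of the averaged particle excess under the unnormalized Gibbs measure. -/
theorem exists_springMeasure_bound {V : Vec k → Vec k → ℝ → ℝ} {γ ρ κ G δ : ℝ} (hρ : 0 < ρ)
    (hγ : 0 < γ) (hV : PairBounds D V g κ (cell D ρ / 4) G)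
    (hVm : Measurable fun q : Vec k × Vec k × ℝ => V q.1 q.2.1 q.2.2) (hδ : 0 < δ) :
    ∃ C : ℝ, 0 ≤ C ∧ ∀ (L x r : ℝ) (N : ℕ), 0 < r →
      springMeasure D V γ (cell D ρ) L N {ω | δ ≤ 1 / r * |∫ u in (0 : ℝ)..r,
        excess D ρ L (L + N * cell D ρ) ω (x + u)|} ≤
      ENNReal.ofReal (C * Real.exp (-(γ * cell D ρ) * δ ^ 2 * r)) *
        springMeasure D V γ (cell D ρ) L N univ := by
  have hlam := cell_pos D hρ
  set lam := cell D ρ with hlamdef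
  -- The minimizer of (r/λ)t²/(4γ) - trδ, with minimum -γλδ²r.
  set t : ℝ := 2 * γ * lam * δ with ht
  have ht0 : 0 ≤ t := by positivity
  obtain ⟨C₁, hC₁, M₁, h₁⟩ := exists_tilt hV hVm hlam hγ ht0 t
  obtain ⟨C₂, hC₂, M₂, h₂⟩ := exists_tilt hV hVm hlam hγ ht0 (-t)
  set M := max M₁ M₂
  set B : ℝ := Real.exp (t * (lam / 2) + t ^ 2 / (4 * γ)) with hB
  -- For N < M the integral is at most M²λ: either the event is empty, or rδ ≤ M²λ and this constant
  -- makes the bound trivial.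
  set C₃ : ℝ := Real.exp (γ * lam * δ * (M ^ 2 * lam)) with hC₃
  refine ⟨(C₁ + C₂) * B + C₃, by positivity, fun L x r N hr => ?_⟩
  have hset : ∀ ω : Fin N → ℝ × Vec k, (δ ≤ 1 / r * |∫ u in (0 : ℝ)..r,
        excess D ρ L (L + N * lam) ω (x + u)|) ↔
        r * δ ≤ |∫ u in (0 : ℝ)..r, excess D ρ L (L + N * lam) ω (x + u)| := by
    intro ω
    rw [one_div, inv_mul_eq_div, le_div_iff₀ hr, mul_comm]
  simp only [hset]
  have hrδ : 0 < r * δ := by positivity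
  have hexcess := integral_excess hlam L x hr N
  simp only [← hlamdef] at hexcess
  rcases hexcess with h0 | ⟨a, b, ha, hab, hb, hbar, hI⟩
  · have : {ω : Fin N → ℝ × Vec k | r * δ ≤ |∫ u in (0 : ℝ)..r,
        excess D ρ L (L + N * lam) ω (x + u)|} = ∅ := by
      ext ω
      simp only [h0, abs_zero, mem_ofPred_eq, mem_empty_iff_false, iff_false, not_le]
      exact hrδ
    rw [this, measure_empty]
    exact zero_le
  simp only [hI]
  have hexp0 := Real.exp_pos (-(γ * lam) * δ ^ 2 * r)
  by_cases hNM : M ≤ N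
  · obtain ⟨n₁, n₂, h12, h2N, hcard, hu₁, hu₂, hbd⟩ := exists_excess_bounds (k := k) hlam ha hab hb
    have hcard' : ((n₂ - n₁ : ℕ) : ℝ) ≤ r / lam + 1 := hcard.trans (by gcongr)
    have hexp : Real.exp (t * (lam / 2) - t * (r * δ)) *
        Real.exp (((n₂ - n₁ : ℕ) : ℝ) * (t ^ 2 / (4 * γ)))
        ≤ B * Real.exp (-(γ * lam) * δ ^ 2 * r) := by
      rw [← Real.exp_add, hB, ← Real.exp_add, Real.exp_le_exp]
      have e1 : ((n₂ - n₁ : ℕ) : ℝ) * (t ^ 2 / (4 * γ)) ≤ (r / lam + 1) * (t ^ 2 / (4 * γ)) := by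
        gcongr
      have e2 : r / lam * (t ^ 2 / (4 * γ)) = γ * lam * δ ^ 2 * r := by
        rw [ht]; field_simp; ring
      have e3 : t * (r * δ) = 2 * (γ * lam * δ ^ 2 * r) := by rw [ht]; ring
      linarith
    have T₁ := springMeasure_tail (D := D) (V := V) (γ := γ) (a := r * δ) hVm ht0
      (I := fun ω => ((b - L) ^ 2 - (a - L) ^ 2) / (2 * lam) - ∑ j, max (b - max a (ω j).1) 0)
      (fun ω => by
        have := mul_le_mul_of_nonneg_left (hbd ω).1 ht0
        linarith)
      (h₁ ((le_max_left _ _).trans hNM) h12 h2N (.inl rfl) hu₁)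
    have T₂ := springMeasure_tail (D := D) (V := V) (γ := γ) (a := r * δ) hVm ht0
      (I := fun ω => -(((b - L) ^ 2 - (a - L) ^ 2) / (2 * lam) - ∑ j, max (b - max a (ω j).1) 0))
      (fun ω => by
        have := mul_le_mul_of_nonneg_left (hbd ω).2 ht0
        linarith)
      (h₂ ((le_max_right _ _).trans hNM) h12 h2N (.inr rfl) hu₂)
    rw [neg_sq] at T₂
    have hsub : {ω : Fin N → ℝ × Vec k | r * δ ≤ |((b - L) ^ 2 - (a - L) ^ 2) / (2 * lam)
        - ∑ j, max (b - max a (ω j).1) 0|} ⊆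
        {ω | r * δ ≤ ((b - L) ^ 2 - (a - L) ^ 2) / (2 * lam) - ∑ j, max (b - max a (ω j).1) 0} ∪
        {ω | r * δ ≤ -(((b - L) ^ 2 - (a - L) ^ 2) / (2 * lam)
          - ∑ j, max (b - max a (ω j).1) 0)} := by
      intro ω hω
      rw [mem_ofPred_eq] at hω
      rw [mem_union, mem_ofPred_eq, mem_ofPred_eq]
      exact le_abs.1 hω
    refine (measure_mono hsub).trans ((measure_union_le _ _).trans ((add_le_add T₁ T₂).trans ?_))
    rw [← add_mul, ← ENNReal.ofReal_add (by positivity) (by positivity)]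
    refine mul_le_mul_left (ENNReal.ofReal_le_ofReal ?_) _
    have e1 := mul_le_mul_of_nonneg_left hexp hC₁
    have e2 := mul_le_mul_of_nonneg_left hexp hC₂
    have e3 : 0 ≤ C₃ * Real.exp (-(γ * lam) * δ ^ 2 * r) := by positivity
    linarith
  · by_cases hbig : r * δ ≤ M ^ 2 * lam
    · refine (measure_mono (subset_univ _)).trans (le_mul_of_one_le_left zero_le ?_)
      rw [ENNReal.one_le_ofReal]
      have e1 : 1 ≤ C₃ * Real.exp (-(γ * lam) * δ ^ 2 * r) := by
        rw [hC₃, ← Real.exp_add, Real.one_le_exp_iff]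
        have := mul_le_mul_of_nonneg_left hbig (show 0 ≤ γ * lam * δ by positivity)
        linarith
      have e2 : 0 ≤ (C₁ + C₂) * B * Real.exp (-(γ * lam) * δ ^ 2 * r) := by positivity
      linarith
    · have : {ω : Fin N → ℝ × Vec k | r * δ ≤ |((b - L) ^ 2 - (a - L) ^ 2) / (2 * lam)
        - ∑ j, max (b - max a (ω j).1) 0|} = ∅ := by
        ext ω
        simp only [mem_ofPred_eq, mem_empty_iff_false, iff_false, not_le]
        refine (abs_integral_excess_le hlam ha hab hb ω).trans_lt ?_
        refine lt_of_le_of_lt ?_ (not_le.1 hbig)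
        have : (N : ℝ) ≤ M := by exact_mod_cast (not_le.1 hNM).le
        gcongr
      rw [this, measure_empty]
      exact zero_le

theorem gibbs_eq [Countable ι] (hD : D.IsAdmissible ev φ g) {ρ : ℝ} (hρ : 0 < ρ) (q β θ : ℝ)
    {n₁ n₂ : ℤ} (hn : 0 ≤ n₁ + n₂) :
    right D ρ θ n₂ = left D ρ θ n₁ + (count n₁ n₂ : ℝ) * cell D ρ ∧
    gibbs D ev φ ρ q β θ n₁ n₂ =
      (springMeasure D (fun y y' t => β * q ^ 2 * V₂inside D ev φ y y' t) (β * q ^ 2 * ρ / 2)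
        (cell D ρ) (left D ρ θ n₁) (count n₁ n₂) univ)⁻¹ •
      springMeasure D (fun y y' t => β * q ^ 2 * V₂inside D ev φ y y' t) (β * q ^ 2 * ρ / 2)
        (cell D ρ) (left D ρ θ n₁) (count n₁ n₂) := by
  have hcast : (count n₁ n₂ : ℝ) = n₁ + n₂ := by
    rw [count]
    exact_mod_cast congrArg (Int.cast : ℤ → ℝ) (Int.toNat_of_nonneg hn)
  have hright : right D ρ θ n₂ = left D ρ θ n₁ + (count n₁ n₂ : ℝ) * cell D ρ := by
    rw [hcast, left, right]; ring
  refine ⟨hright, ?_⟩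
  obtain ⟨c, hc, hb⟩ := boltzmann_eq hD hρ q β (left D ρ θ n₁) (count n₁ n₂)
  have hc0 : ENNReal.ofReal c ≠ 0 := (ENNReal.ofReal_pos.2 hc).ne'
  simp only [gibbs]
  rw [hright, hb, Measure.smul_apply, smul_smul, smul_eq_mul,
    ENNReal.mul_inv (.inl hc0) (.inl ENNReal.ofReal_ne_top), mul_right_comm,
    ENNReal.inv_mul_cancel hc0 ENNReal.ofReal_ne_top, one_mul]

end Jellium

theorem theorem3 {k : ℕ} (D : Jellium.CrossSection k) {ι : Type} [Countable ι] (ev : ι → ℝ)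
    (φ : ι → Jellium.Vec k → ℝ) (g : ℝ → ℝ) (hD : D.IsAdmissible ev φ g)
    (ρ q β : ℝ) (hρ : 0 < ρ) (hq : 0 < q) (hβ : 0 < β) :
    ∃ α : ℝ, 0 < α ∧ ∀ δ : ℝ, 0 < δ → ∃ C : ℝ,
      ∀ θ : ℝ, 0 ≤ θ → θ < 1 → ∀ n₁ n₂ : ℤ, 0 ≤ n₁ + n₂ →
        IsProbabilityMeasure (Jellium.gibbs D ev φ ρ q β θ n₁ n₂) ∧
        ∀ x r : ℝ, 0 < r →
          (Jellium.gibbs D ev φ ρ q β θ n₁ n₂).real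
            {ω | δ ≤ 1 / r * |∫ u in (0 : ℝ)..r, Jellium.excess D ρ (Jellium.left D ρ θ n₁)
              (Jellium.right D ρ θ n₂) ω (x + u)|}
          ≤ C * Real.exp (-α * δ ^ 2 * r) := by
  have hγ : 0 < β * q ^ 2 * ρ / 2 := by positivity
  have hcell := Jellium.cell_pos D hρ
  obtain ⟨κ, G, hV⟩ := Jellium.exists_pairBounds hD (b := β * q ^ 2) (by positivity) hcell
  have hVm : Measurable fun z : Jellium.Vec k × Jellium.Vec k × ℝ =>
      β * q ^ 2 * Jellium.V₂inside D ev φ z.1 z.2.1 z.2.2 :=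
    (Jellium.measurable_V₂inside hD).const_mul _
  -- The rate γλ equals βq²/(2W).
  refine ⟨β * q ^ 2 * ρ / 2 * Jellium.cell D ρ, mul_pos hγ hcell, fun δ hδ => ?_⟩
  obtain ⟨C, hC0, hC⟩ := Jellium.exists_springMeasure_bound hρ hγ hV hVm hδ
  refine ⟨C, fun θ _ _ n₁ n₂ hn => ?_⟩
  obtain ⟨hright, hgibbs⟩ := Jellium.gibbs_eq hD hρ q β θ hn
  have h0 := Jellium.springMeasure_univ_ne_zero (D := D)
    (V := fun y y' t => β * q ^ 2 * Jellium.V₂inside D ev φ y y' t) (γ := β * q ^ 2 * ρ / 2) hcell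
    (Jellium.left D ρ θ n₁) (Jellium.count n₁ n₂) hVm
  have htop := Jellium.springMeasure_univ_ne_top hγ.le hV (Jellium.left D ρ θ n₁)
    (Jellium.count n₁ n₂)
  rw [hgibbs, hright]
  refine ⟨⟨?_⟩, fun x r hr => ?_⟩
  · rw [Measure.smul_apply, smul_eq_mul, ENNReal.inv_mul_cancel h0 htop]
  · rw [measureReal_def, Measure.smul_apply, smul_eq_mul]
    refine ENNReal.toReal_le_of_le_ofReal (by positivity) ?_
    rw [← ENNReal.div_eq_inv_mul]
    exact ENNReal.div_le_of_le_mul (hC (Jellium.left D ρ θ n₁) x r (Jellium.count n₁ n₂) hr)
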